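/- A (finite) ribbon graph $G$ is a surface with boundary that is the union of finitely many closed discs, the vertex-discs $V(G)$ and the edge-ribbons $E(G)$, such that vertex-discs and edge-ribbons meet in disjoint line segments, each segment lies on the boundary of exactly one vertex-disc and exactly one edge-ribbon, and each edge-ribbon contains exactly two of them (its half-edges). It is presented by its signed rotation system: orient every vertex-disc, record the cyclic order of the half-edges around each vertex-disc, and give each half-edge a sign $\pm$, where the two half-edges of an edge have equal signs if the edge is untwisted (its ribbon is compatible with the orientations of the vertex-discs at its ends) and opposite signs if it is twisted. Let $F(G)$ be the set of boundary components of the surface (an isolated vertex-disc contributing one) and $c(G)$ the number of connected components. The Euler genus of $G$ is $\varepsilon(G)=2c(G)-\bigl(|V(G)|-|E(G)|+|F(G)|\bigr)$. Let $e$ be an edge joining two distinct vertex-discs. The contraction $G/e$ replaces $e$ and its two end-discs by their union, a single vertex-disc. In the signed rotation system: if the end-discs have rotations $(e\,A)$ and $(e'\,B)$, where $e,e'$ are the half-edges of $e$, then the new vertex-disc has rotation $(A\,B)$ if $e$ is untwisted and $(A\,B^{-1})$ if $e$ is twisted, where $B^{-1}$ is $B$ in reversed order with all signs changed. A bouquet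 is a ribbon graph with exactly one vertex-disc. Two loops of a bouquet $B$ are interlaced if their half-edges alternate in the cyclic order. The signed intersection graph $SI(B)$ has the loops of $B$ as vertices, two of them being adjacent if they are interlaced, and a vertex has sign $-$ if the loop is twisted and $+$ otherwise. Its adjacency matrix $\mathrm{adj}(SI(B))$ over $\mathrm{GF}(2)$ is the adjacency matrix of the underlying simple graph with, in addition, a diagonal entry $1$ at each vertex of sign $-$. **Theorem.** Let $G$ be a connected ribbon graph and let $T$ be any spanning tree of $G$. Let $Aux(G,T)$ be the ribbon graph obtained from $G$ by contracting all edges of $T$ one after another, in any order. Then $Aux(G,T)$ is a bouquet with edge set $E(G)\setminus E(T)$, and $$\varepsilon(G)=\operatorname{rank}_{\mathrm{GF}(2)}\bigl(\mathrm{adj}(SI(Aux(G,T)))\bigr).$$ -/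

import Mathlib

/-- A (finite) ribbon graph with vertex-discs labelled in `V` and edge-ribbons labelled in `E`,
presented by its signed rotation system. The half-edges (ribbon ends) of an edge `e` are `(e, false)`
and `(e, true)`. Every vertex-disc carries an orientation; `next` sends a half-edge to the one that
follows it in the cyclic order around its vertex-disc, and every half-edge carries a sign.
Vertices without half-edges are allowed. The values of `inc`, `sign` at labels that are not edges
are irrelevant. -/
structure RibbonGraph (V E : Type*) where
  /-- the vertex-discs -/
  verts : Finset V
  /-- the edge-ribbons -/
  edges : Finset E
  /-- the vertex-disc to which a half-edge is attached -/
  inc : E × Bool → V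
  /-- the rotation -/
  next : Equiv.Perm (E × Bool)
  /-- the signs of the half-edges -/
  sign : E × Bool → ℤˣ
  inc_mem : ∀ h : E × Bool, h.1 ∈ edges → inc h ∈ verts
  next_of_notMem : ∀ h : E × Bool, h.1 ∉ edges → next h = h
  inc_next : ∀ h : E × Bool, inc (next h) = inc h
  sameCycle_of_inc_eq : ∀ h k : E × Bool, h.1 ∈ edges → k.1 ∈ edges → inc h = inc k →
    next.SameCycle h k

/-- A graph whose vertices carry signs; `neg` is the set of vertices with sign `-`. -/
structure SignedGraph (W : Type*) where
  graph : SimpleGraph W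
  neg : Set W

open Classical in
/-- The adjacency matrix over `GF(2)`, with a `1` on the diagonal at each vertex of sign `-`. -/
noncomputable def SignedGraph.adj {W : Type*} (S : SignedGraph W) : Matrix W W (ZMod 2) :=
  S.graph.adjMatrix (ZMod 2) + Matrix.diagonal (fun w => if w ∈ S.neg then 1 else 0)

namespace RibbonGraph

variable {V E : Type*}

/-! ### Underlying graph, connectedness, spanning trees -/

/-- The unordered pair of end-vertices of an edge. -/
def ends (G : RibbonGraph V E) (e : E) : Sym2 V := s(G.inc (e, false), G.inc (e, true))

/-- The simple graph underlying the spanning subgraph with edge set `S`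
(loops dropped, parallel edges identified). -/
def simpleGraph (G : RibbonGraph V E) (S : Finset E) : SimpleGraph {v // v ∈ G.verts} :=
  SimpleGraph.fromRel fun u v => ∃ e ∈ S, G.ends e = s(u.1, v.1)

/-- `G` is connected (in particular it has a vertex). -/
def Connected (G : RibbonGraph V E) : Prop := (G.simpleGraph G.edges).Connected

/-- The number `c(G)` of connected components. -/
noncomputable def numComponents (G : RibbonGraph V E) : ℕ :=
  Nat.card (G.simpleGraph G.edges).ConnectedComponent

/-- `T` is the edge set of a spanning tree of `G`: it contains no loops and no two parallel edges,
and the resulting simple graph on all the vertices of `G` is a tree. -/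
structure IsSpanningTree (G : RibbonGraph V E) (T : Finset E) : Prop where
  subset : T ⊆ G.edges
  not_loop : ∀ e ∈ T, ¬ (G.ends e).IsDiag
  not_parallel : Set.InjOn G.ends T
  isTree : (G.simpleGraph T).IsTree

/-- A bouquet is a ribbon graph with exactly one vertex. -/
def IsBouquet (G : RibbonGraph V E) : Prop := G.verts.card = 1

/-! ### Faces and Euler genus -/

/-- An edge is twisted if its two half-edges carry opposite signs. For a loop this says that its
ribbon together with the vertex-disc is a Möbius band. -/
def Twisted (G : RibbonGraph V E) (e : E) : Prop := G.sign (e, false) ≠ G.sign (e, true)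

/-- The corners of `G`: the end points of the segments in which ribbons meet discs. Going round a
disc along its orientation, one passes first `(h, false)` and then `(h, true)` at the half-edge
`h`. -/
def Corner (G : RibbonGraph V E) : Type _ := {c : (E × Bool) × Bool // c.1.1 ∈ G.edges}

/-- Two corners are joined by a piece of the boundary of the surface `G`. This is either the arc of
a disc from the end of a half-edge to the beginning of the next half-edge, or one of the two free
sides of a ribbon; such a side joins a beginning to an end if the ribbon is untwisted, and
a beginning to a beginning or an end to an end if it is twisted. -/
inductive BoundaryStep (G : RibbonGraph V E) : G.Corner → G.Corner → Prop
  | arc (c d : G.Corner) (hc : c.1.2 = true) (hd : d.1 = (G.next c.1.1, false)) :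
      BoundaryStep G c d
  | untwisted (c d : G.Corner) (e : E) (i : Bool) (he : ¬ G.Twisted e)
      (hc : c.1 = ((e, false), i)) (hd : d.1 = ((e, true), !i)) : BoundaryStep G c d
  | twisted (c d : G.Corner) (e : E) (i : Bool) (he : G.Twisted e)
      (hc : c.1 = ((e, false), i)) (hd : d.1 = ((e, true), i)) : BoundaryStep G c d

/-- The faces of `G`, that is, the boundary components of the surface: the cycles of boundary pieces,
and the boundary circles of the vertex-discs without half-edges. -/
def Face (G : RibbonGraph V E) : Type _ :=
  Quot G.BoundaryStep ⊕ {v // v ∈ G.verts ∧ ∀ h : E × Bool, h.1 ∈ G.edges → G.inc h ≠ v}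

/-- The Euler characteristic `|V| - |E| + |F|`. -/
noncomputable def eulerChar (G : RibbonGraph V E) : ℤ :=
  G.verts.card - G.edges.card + Nat.card G.Face

/-- The Euler genus `2c - χ`. -/
noncomputable def eulerGenus (G : RibbonGraph V E) : ℤ := 2 * G.numComponents - G.eulerChar

/-! ### Signed intersection graph -/

/-- Following the rotation from `x`, one meets `y` strictly before meeting `z`. -/
def Meets (G : RibbonGraph V E) (x y z : E × Bool) : Prop :=
  ∃ k : ℕ, 0 < k ∧ (G.next ^ k) x = y ∧ ∀ j : ℕ, 0 < j → j ≤ k → (G.next ^ j) x ≠ z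

/-- `x, y, z, w` appear in this cyclic order in the rotation. -/
def InCyclicOrder (G : RibbonGraph V E) (x y z w : E × Bool) : Prop :=
  G.Meets x y z ∧ G.Meets y z w ∧ G.Meets z w x ∧ G.Meets w x y

/-- The half-edges of `e` and `f` alternate in the rotation. -/
def Interlaced (G : RibbonGraph V E) (e f : E) : Prop :=
  ∃ i j : Bool, G.InCyclicOrder (e, i) (f, j) (e, !i) (f, !j)

theorem Interlaced.symm {G : RibbonGraph V E} {e f : E} (h : G.Interlaced e f) :
    G.Interlaced f e := by
  obtain ⟨i, j, h1, h2, h3, h4⟩ := h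
  exact ⟨j, !i, by rw [Bool.not_not]; exact ⟨h2, h3, h4, h1⟩⟩

/-- The intersection graph of a bouquet. -/
def intersectionGraph (B : RibbonGraph V E) : SimpleGraph {e // e ∈ B.edges} where
  Adj e f := e ≠ f ∧ B.Interlaced e.1 f.1
  symm := ⟨fun _ _ h => ⟨h.1.symm, h.2.symm⟩⟩
  loopless := ⟨fun _ h => h.1 rfl⟩

/-- The signed intersection graph of a bouquet: twisted loops have sign `-`. -/
def signedIntersectionGraph (B : RibbonGraph V E) : SignedGraph {e // e ∈ B.edges} where
  graph := B.intersectionGraph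
  neg := {e | B.Twisted e.1}

/-! ### Contraction of edges -/

theorem inc_symm_next (G : RibbonGraph V E) (h : E × Bool) : G.inc (G.next.symm h) = G.inc h := by
  conv_rhs => rw [← G.next.apply_symm_apply h]
  rw [G.inc_next]

theorem inc_eq_of_sameCycle (G : RibbonGraph V E) {h k : E × Bool} (hk : G.next.SameCycle h k) :
    G.inc h = G.inc k := by
  have key : ∀ (n : ℕ) (x : E × Bool), G.inc ((G.next ^ n) x) = G.inc x := by
    intro n
    induction n with
    | zero => intro x; rfl
    | succ n ih => intro x; rw [pow_succ', Equiv.Perm.mul_apply, G.inc_next, ih]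
  obtain ⟨i, rfl⟩ := hk
  obtain ⟨n, rfl | rfl⟩ := i.eq_nat_or_neg
  · simp [key]
  · rw [← key n ((G.next ^ (-(n : ℤ))) h)]
    simp

theorem sameCycle_of_step {α : Type*} {π σ : Equiv.Perm α} (hs : ∀ x, σ.SameCycle x (π x))
    {x y : α} (h : π.SameCycle x y) : σ.SameCycle x y := by
  have key : ∀ (n : ℕ) (x : α), σ.SameCycle x ((π ^ n) x) := by
    intro n
    induction n with
    | zero => intro x; exact Equiv.Perm.SameCycle.rfl
    | succ n ih =>
      intro x
      rw [pow_succ', Equiv.Perm.mul_apply]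
      exact (ih x).trans (hs _)
  obtain ⟨i, rfl⟩ := h
  obtain ⟨n, rfl | rfl⟩ := i.eq_nat_or_neg
  · simpa using key n x
  · have := key n ((π ^ (-(n : ℤ))) x)
    simpa using this.symm

/-- Removing the point `a` from its cycle: the predecessor of `a` is sent to the successor of `a`,
and `a` becomes a fixed point. -/
def removePoint {α : Type*} [DecidableEq α] (π : Equiv.Perm α) (a : α) : Equiv.Perm α :=
  Equiv.swap a (π a) * π

theorem removePoint_self {α : Type*} [DecidableEq α] (π : Equiv.Perm α) (a : α) :
    removePoint π a a = a := by
  simp [removePoint]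

theorem removePoint_of_eq {α : Type*} [DecidableEq α] {π : Equiv.Perm α} {a x : α}
    (hx : π x = a) : removePoint π a x = π a := by
  simp [removePoint, hx]

theorem removePoint_of_ne {α : Type*} [DecidableEq α] {π : Equiv.Perm α} {a x : α}
    (hxa : x ≠ a) (hx : π x ≠ a) : removePoint π a x = π x := by
  rw [removePoint, Equiv.Perm.mul_apply, Equiv.swap_apply_of_ne_of_ne hx]
  exact fun h => hxa (π.injective h)

theorem removePoint_invariant {α β : Type*} [DecidableEq α] {π : Equiv.Perm α} (f : α → β)
    (hf : ∀ x, f (π x) = f x) (a x : α) : f (removePoint π a x) = f x := by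
  by_cases hxa : x = a
  · rw [hxa, removePoint_self]
  by_cases hx : π x = a
  · rw [removePoint_of_eq hx, hf, ← hx, hf]
  · rw [removePoint_of_ne hxa hx, hf]

theorem sameCycle_removePoint {α : Type*} [DecidableEq α] {π : Equiv.Perm α} {a x y : α}
    (hx : x ≠ a) (hy : y ≠ a) (h : π.SameCycle x y) : (removePoint π a).SameCycle x y := by
  have key : ∀ (n : ℕ) (x : α), x ≠ a →
      ((π ^ n) x ≠ a → (removePoint π a).SameCycle x ((π ^ n) x)) ∧
      ((π ^ n) x = a → (removePoint π a).SameCycle x (π a)) := by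
    intro n
    induction n with
    | zero => intro x hx; exact ⟨fun _ => Equiv.Perm.SameCycle.rfl, fun h => absurd h hx⟩
    | succ n ih =>
      intro x hx
      obtain ⟨h1, h2⟩ := ih x hx
      rw [pow_succ', Equiv.Perm.mul_apply]
      by_cases hn : (π ^ n) x = a
      · rw [hn]
        exact ⟨fun _ => h2 hn, fun h => by have := h2 hn; rwa [h] at this ⊢⟩
      · refine ⟨fun h => ?_, fun h => ?_⟩
        · rw [← removePoint_of_ne hn h]
          exact (h1 hn).apply_right
        · rw [← removePoint_of_eq h]
          exact (h1 hn).apply_right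
  obtain ⟨i, hi⟩ := h
  obtain ⟨n, rfl | rfl⟩ := i.eq_nat_or_neg
  · have hn : (π ^ n) x = y := by simpa using hi
    have := (key n x hx).1
    rw [hn] at this
    exact this hy
  · have hn : (π ^ n) y = x := by rw [← hi]; simp
    have := (key n y hy).1
    rw [hn] at this
    exact (this hx).symm

theorem next_mem (G : RibbonGraph V E) {h : E × Bool} (hh : h.1 ∈ G.edges) :
    (G.next h).1 ∈ G.edges := by
  by_contra hn
  have := G.next.injective (G.next_of_notMem _ hn)
  rw [this] at hn
  exact hn hh

theorem exists_pow_next_eq (G : RibbonGraph V E) (b : E × Bool) :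
    ∃ n : ℕ, (G.next ^ (n + 1)) b = b := by
  by_cases hb : b.1 ∈ G.edges
  · have hmem : ∀ n : ℕ, ((G.next ^ n) b) ∈ ((G.edges ×ˢ Finset.univ : Finset (E × Bool))) := by
      intro n
      induction n with
      | zero => simpa using hb
      | succ n ih =>
        rw [pow_succ', Equiv.Perm.mul_apply]
        simp only [Finset.mem_product, Finset.mem_univ, and_true] at ih ⊢
        exact G.next_mem ih
    obtain ⟨m, n, hmn, h⟩ := Set.Finite.exists_lt_map_eq_of_forall_mem
      (t := ((G.edges ×ˢ Finset.univ : Finset (E × Bool)) : Set (E × Bool)))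
      (f := fun n : ℕ => (G.next ^ n) b) (fun n => hmem n) (Finset.finite_toSet _)
    obtain ⟨k, rfl⟩ := Nat.exists_eq_add_of_lt hmn
    refine ⟨k, ?_⟩
    simp only [add_assoc, pow_add, Equiv.Perm.mul_apply] at h
    have := (G.next ^ m).injective h
    rw [pow_add, Equiv.Perm.mul_apply]
    exact this.symm
  · exact ⟨0, by simpa using G.next_of_notMem b hb⟩

theorem sameCycle_mul_swap [DecidableEq E] (G : RibbonGraph V E) {a b h k : E × Bool}
    (hab : G.inc a ≠ G.inc b) :
    (G.next.SameCycle h k → (G.next * Equiv.swap a b).SameCycle h k) ∧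
      (G.next * Equiv.swap a b).SameCycle a b := by
  set σ := G.next * Equiv.swap a b with hσ
  have ha : σ a = G.next b := by simp [hσ]
  have hb : σ b = G.next a := by simp [hσ]
  have hne : ∀ x, x ≠ a → x ≠ b → σ x = G.next x := fun x h1 h2 => by
    rw [hσ, Equiv.Perm.mul_apply, Equiv.swap_apply_of_ne_of_ne h1 h2]
  have hcyc : σ.SameCycle a b := by
    by_contra hcon
    have key : ∀ n : ℕ, σ.SameCycle a ((G.next ^ (n + 1)) b) := by
      intro n
      induction n with
      | zero =>
        rw [zero_add, pow_one, ← ha]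
        exact Equiv.Perm.SameCycle.rfl.apply_right
      | succ n ih =>
        rw [pow_succ', Equiv.Perm.mul_apply, ← hne]
        · exact ih.apply_right
        · intro h
          apply hab
          rw [← h]
          exact (G.inc_eq_of_sameCycle (Equiv.Perm.SameCycle.rfl.pow_right)).symm
        · intro h
          rw [h] at ih
          exact hcon ih
    obtain ⟨n, hn⟩ := G.exists_pow_next_eq b
    exact hcon (by simpa [hn] using key n)
  refine ⟨fun h => sameCycle_of_step (fun x => ?_) h, hcyc⟩
  by_cases hxa : x = a
  · rw [hxa, ← hb]; exact hcyc.apply_right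
  by_cases hxb : x = b
  · rw [hxb, ← ha]; exact hcyc.symm.apply_right
  rw [← hne x hxa hxb]
  exact Equiv.Perm.SameCycle.rfl.apply_right

variable [DecidableEq V]

/-- Reversing the orientation of the vertex-disc `v`: the rotation at `v` is reversed and
all signs at `v` are multiplied by `-1`. The ribbon graph stays the same up to equivalence. -/
def flip (G : RibbonGraph V E) (v : V) : RibbonGraph V E where
  verts := G.verts
  edges := G.edges
  inc := G.inc
  next :=
    { toFun := fun h => if G.inc h = v then G.next.symm h else G.next h
      invFun := fun h => if G.inc h = v then G.next h else G.next.symm h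
      left_inv := fun h => by
        by_cases hv : G.inc h = v <;> simp [hv, inc_symm_next, inc_next]
      right_inv := fun h => by
        by_cases hv : G.inc h = v <;> simp [hv, inc_symm_next, inc_next] }
  sign := fun h => if G.inc h = v then -G.sign h else G.sign h
  inc_mem := G.inc_mem
  next_of_notMem := fun h hh => by
    have h1 := G.next_of_notMem h hh
    have h2 : G.next.symm h = h := by rw [Equiv.symm_apply_eq, h1]
    simp [h1, h2]
  inc_next := fun h => by
    by_cases hv : G.inc h = v <;> simp [hv, inc_symm_next, inc_next]
  sameCycle_of_inc_eq := fun h k hh hk hhk => by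
    refine sameCycle_of_step (fun x => ?_) (G.sameCycle_of_inc_eq h k hh hk hhk)
    by_cases hv : G.inc x = v
    · refine Equiv.Perm.SameCycle.symm ⟨1, ?_⟩
      simp [hv, inc_next]
    · exact ⟨1, by simp [hv]⟩

variable [DecidableEq E]

/-- The rotation `(A B)` obtained from the rotations `(e A)` and `(e' B)`, where `e`, `e'` are the two
half-edges of an edge; the half-edges of the edge become fixed points. -/
def mergeNext (G : RibbonGraph V E) (e : E) : Equiv.Perm (E × Bool) :=
  removePoint (removePoint (G.next * Equiv.swap (e, false) (e, true)) (e, false)) (e, true)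

/-- Contraction of an untwisted edge `e` that joins two distinct vertex-discs with rotations `(e A)`
and `(e B)`: they are replaced by one vertex-disc with rotation `(A B)`. The new disc gets the label
of the vertex-disc at the half-edge `(e, false)`. -/
def merge (G : RibbonGraph V E) (e : E) (he : e ∈ G.edges)
    (hne : G.inc (e, false) ≠ G.inc (e, true)) : RibbonGraph V E where
  verts := G.verts.erase (G.inc (e, true))
  edges := G.edges.erase e
  inc := fun h => if G.inc h = G.inc (e, true) then G.inc (e, false) else G.inc h
  next := G.mergeNext e
  sign := G.sign
  inc_mem := fun h hh => by
    have h1 := G.inc_mem h (Finset.mem_of_mem_erase hh)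
    by_cases hv : G.inc h = G.inc (e, true)
    · rw [if_pos hv]
      exact Finset.mem_erase.2 ⟨hne, G.inc_mem (e, false) he⟩
    · rw [if_neg hv]
      exact Finset.mem_erase.2 ⟨hv, h1⟩
  next_of_notMem := fun h hh => by
    have h0 : removePoint (G.next * Equiv.swap (e, false) (e, true)) (e, false) (e, false)
        = (e, false) := removePoint_self _ _
    have hft : ((e, false) : E × Bool) ≠ (e, true) := by simp
    by_cases h1 : h = (e, true)
    · rw [h1, mergeNext, removePoint_self]
    by_cases h2 : h = (e, false)
    · rw [h2, mergeNext, removePoint_of_ne hft (by rw [h0]; exact hft), h0]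
    have h3 : h.1 ≠ e := by
      rintro rfl
      rcases h with ⟨x, _ | _⟩ <;> simp at h1 h2
    have h4 : h.1 ∉ G.edges := fun hm => hh (Finset.mem_erase.2 ⟨h3, hm⟩)
    have h5 : (G.next * Equiv.swap (e, false) (e, true)) h = h := by
      rw [Equiv.Perm.mul_apply, Equiv.swap_apply_of_ne_of_ne h2 h1, G.next_of_notMem h h4]
    have h6 : removePoint (G.next * Equiv.swap (e, false) (e, true)) (e, false) h = h := by
      rw [removePoint_of_ne h2 (by rw [h5]; exact h2), h5]
    rw [mergeNext, removePoint_of_ne h1 (by rw [h6]; exact h1), h6]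
  inc_next := fun h => by
    refine removePoint_invariant
      (fun h => if G.inc h = G.inc (e, true) then G.inc (e, false) else G.inc h)
      (fun x => removePoint_invariant
        (fun h => if G.inc h = G.inc (e, true) then G.inc (e, false) else G.inc h)
        (fun x => ?_) _ _) _ _
    by_cases h1 : x = (e, true)
    · simp [h1, G.inc_next]
    by_cases h2 : x = (e, false)
    · simp [h2, G.inc_next]
    rw [Equiv.Perm.mul_apply, Equiv.swap_apply_of_ne_of_ne h2 h1, G.inc_next]
  sameCycle_of_inc_eq := fun h k hh hk hhk => by
    have hh' := Finset.mem_erase.1 hh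
    have hk' := Finset.mem_erase.1 hk
    have hne' : ∀ x : E × Bool, x.1 ≠ e → ∀ i, x ≠ (e, i) := fun x hx i h => hx (by rw [h])
    refine sameCycle_removePoint (hne' h hh'.1 _) (hne' k hk'.1 _)
      (sameCycle_removePoint (hne' h hh'.1 _) (hne' k hk'.1 _) ?_)
    obtain ⟨-, hc⟩ := G.sameCycle_mul_swap (h := h) (k := k) hne
    have step : ∀ x y : E × Bool, x.1 ∈ G.edges → y.1 ∈ G.edges → G.inc x = G.inc y →
        (G.next * Equiv.swap (e, false) (e, true)).SameCycle x y := fun x y hx hy hxy =>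
      (G.sameCycle_mul_swap hne).1 (G.sameCycle_of_inc_eq x y hx hy hxy)
    by_cases h1 : G.inc h = G.inc (e, true) <;> by_cases h2 : G.inc k = G.inc (e, true)
    · exact step h k hh'.2 hk'.2 (h1.trans h2.symm)
    · rw [if_pos h1, if_neg h2] at hhk
      exact ((step h (e, true) hh'.2 he h1).trans hc.symm).trans (step (e, false) k he hk'.2 hhk)
    · rw [if_neg h1, if_pos h2] at hhk
      exact ((step h (e, false) hh'.2 he hhk).trans hc).trans (step (e, true) k he hk'.2 h2.symm)
    · rw [if_neg h1, if_neg h2] at hhk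
      exact step h k hh'.2 hk'.2 hhk

open Classical in
/-- The contraction `G / e` of an edge that joins two distinct vertex-discs `(e A)` and `(± e B)`.
If `e` is untwisted the new vertex-disc has the rotation `(A B)`. If `e` is twisted, it has the
rotation `(A B⁻¹)`, where `B⁻¹` is `B` reversed and with all signs changed.
(Only such edges are contracted: by convention `G / e = G` for all others.) -/
noncomputable def contract (G : RibbonGraph V E) (e : E) : RibbonGraph V E :=
  if h : e ∈ G.edges ∧ G.inc (e, false) ≠ G.inc (e, true) then
    if G.Twisted e then (G.flip (G.inc (e, true))).merge e h.1 h.2 else G.merge e h.1 h.2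
  else G

/-- The ribbon graph obtained from `G` by contracting the edges in the list `l` one after another.
If `l` lists the edges of a spanning tree `T`, this is the auxiliary bouquet of `G` and `T`. -/
noncomputable def aux (G : RibbonGraph V E) (l : List E) : RibbonGraph V E := l.foldl contract G

end RibbonGraph

/-! Contracting an edge between two distinct discs of a connected ribbon graph removes one disc and
one ribbon and changes neither the number of faces nor that of components, so the Euler genus
survives until only a bouquet `B` is left (`contract_spec`, `aux_spec`). For a twisted edge one
end-disc is reversed first, which only relabels corners (`card_quot_flip`); for an untwisted edge
the boundary components are matched by `card_quot_merge`. For the bouquet, let `A` be the adjacency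
matrix and consider functions over GF(2) on the boundary components. `sideDiff` sends such a
function to its jumps across the ribbons. Its kernel consists of the constants (`ker_sideDiff`). Its
range is the kernel of `A` (`range_sideDiff`): jumps `x` determine, up to a constant, a colouring of
the corners that is constant on the arcs of the disc, and `(A x) e` is the difference of its values
at the two ends of a free side of the ribbon `e`, because the half-edges of `f` passed between these
ends are odd in number exactly when `A e f = 1`. Rank-nullity for both maps gives `|F| - 1 = |E| -
rank A`, hence `2 - (1 - |E| + |F|) = rank A`. -/

namespace RibbonGraph

variable {V E : Type*}

/-! ### Positions of half-edges in a cyclic rotation -/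

/-- `pos` numbers the half-edges of `B` by `0, …, N - 1` along the rotation. -/
structure IsPosition (B : RibbonGraph V E) (N : ℕ) (pos : E × Bool → ℕ) : Prop where
  lt : ∀ h : E × Bool, h.1 ∈ B.edges → pos h < N
  inj : ∀ h k : E × Bool, h.1 ∈ B.edges → k.1 ∈ B.edges → pos h = pos k → h = k
  next : ∀ h : E × Bool, h.1 ∈ B.edges → pos (B.next h) = (pos h + 1) % N

theorem pow_next_mem (B : RibbonGraph V E) {h : E × Bool} (hh : h.1 ∈ B.edges) (n : ℕ) :
    ((B.next ^ n) h).1 ∈ B.edges := by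
  induction n with
  | zero => exact hh
  | succ n ih => rw [pow_succ', Equiv.Perm.mul_apply]; exact B.next_mem ih

theorem IsBouquet.exists_isPosition {B : RibbonGraph V E} (hB : B.IsBouquet) {h₀ : E × Bool}
    (h0 : h₀.1 ∈ B.edges) : ∃ N pos, B.IsPosition N pos := by
  classical
  have hex := B.exists_pow_next_eq h₀
  -- The least period of `h₀` is `n + 1`, which will be the number `N` of half-edges.
  set n := Nat.find hex with hn
  have hper : (B.next ^ (n + 1)) h₀ = h₀ := Nat.find_spec hex
  have hmin : ∀ m < n, (B.next ^ (m + 1)) h₀ ≠ h₀ := fun m hm => Nat.find_min hex hm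
  have hmod : ∀ m : ℕ, (B.next ^ (m % (n + 1))) h₀ = (B.next ^ m) h₀ := by
    intro m
    conv_rhs => rw [← Nat.mod_add_div m (n + 1), pow_add, pow_mul, Equiv.Perm.mul_apply,
      Equiv.Perm.pow_apply_eq_self_of_apply_eq_self hper]
  have hinj : ∀ i j : ℕ, i < j → j < n + 1 → (B.next ^ i) h₀ ≠ (B.next ^ j) h₀ := by
    intro i j hij hj h
    obtain ⟨k, rfl⟩ := Nat.exists_eq_add_of_lt hij
    rw [add_assoc, pow_add, Equiv.Perm.mul_apply] at h
    exact hmin k (by omega) ((B.next ^ i).injective h).symm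
  -- The membership sits inside the existential so that `choose` yields a total function; labels
  -- that are not edges get an irrelevant value.
  have hsurj : ∀ h : E × Bool, ∃ j, h.1 ∈ B.edges → j < n + 1 ∧ (B.next ^ j) h₀ = h := by
    intro h
    by_cases hh : h.1 ∈ B.edges
    · obtain ⟨v, hv⟩ := Finset.card_eq_one.1 hB
      have hinc : ∀ k : E × Bool, k.1 ∈ B.edges → B.inc k = v := fun k hk => by
        simpa [hv] using B.inc_mem k hk
      obtain ⟨i, hi⟩ := B.sameCycle_of_inc_eq h₀ h h0 hh ((hinc _ h0).trans (hinc _ hh).symm)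
      refine ⟨(i % ((n + 1 : ℕ) : ℤ)).toNat, fun _ => ⟨?_, ?_⟩⟩
      · have := Int.emod_lt_of_pos i (b := ((n + 1 : ℕ) : ℤ)) (by positivity)
        omega
      · rw [← zpow_natCast, Int.toNat_of_nonneg (Int.emod_nonneg _ (by positivity))]
        have hz : (B.next ^ ((n + 1 : ℕ) : ℤ)) h₀ = h₀ := by rw [zpow_natCast]; exact hper
        conv_rhs => rw [← hi, ← Int.emod_add_mul_ediv i ((n + 1 : ℕ) : ℤ), zpow_add, zpow_mul,
          Equiv.Perm.mul_apply, Equiv.Perm.zpow_apply_eq_self_of_apply_eq_self hz]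
    · exact ⟨0, fun h => absurd h hh⟩
  choose pos hpos using hsurj
  have huniq : ∀ (h : E × Bool) (j : ℕ), h.1 ∈ B.edges → j < n + 1 → (B.next ^ j) h₀ = h →
      pos h = j := by
    intro h j hh hj he
    obtain ⟨h1, h2⟩ := hpos h hh
    rcases lt_trichotomy (pos h) j with hlt | heq | hgt
    · exact absurd (h2.trans he.symm) (hinj _ _ hlt hj)
    · exact heq
    · exact absurd (he.trans h2.symm) (hinj _ _ hgt h1)
  refine ⟨n + 1, pos, fun h hh => (hpos h hh).1, fun h k hh hk hhk => ?_, fun h hh => ?_⟩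
  · rw [← (hpos h hh).2, ← (hpos k hk).2, hhk]
  · refine huniq _ _ (B.next_mem hh) (Nat.mod_lt _ n.succ_pos) ?_
    rw [hmod, pow_succ', Equiv.Perm.mul_apply, (hpos h hh).2]

namespace IsPosition

variable {B : RibbonGraph V E} {N : ℕ} {pos : E × Bool → ℕ}

theorem pow_next (H : B.IsPosition N pos) {h : E × Bool} (hh : h.1 ∈ B.edges) (n : ℕ) :
    pos ((B.next ^ n) h) = (pos h + n) % N := by
  induction n with
  | zero => simpa using (Nat.mod_eq_of_lt (H.lt h hh)).symm
  | succ n ih =>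
    rw [pow_succ', Equiv.Perm.mul_apply, H.next _ (B.pow_next_mem hh n), ih, Nat.mod_add_mod,
      add_assoc]

theorem pow_next_eq_iff (H : B.IsPosition N pos) {h k : E × Bool} (hh : h.1 ∈ B.edges)
    (hk : k.1 ∈ B.edges) (n : ℕ) : (B.next ^ n) h = k ↔ (pos h + n) % N = pos k := by
  rw [← H.pow_next hh]
  exact ⟨fun h => by rw [h], fun e => H.inj _ _ (B.pow_next_mem hh n) hk e⟩

/-- At most one turn around the disc is ever made, so `%` reduces to a case distinction that `omega`
can handle. -/
theorem mod_of_lt_two_mul {a N : ℕ} (h : a < 2 * N) : a % N = if a < N then a else a - N := by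
  split_ifs with h1
  · exact Nat.mod_eq_of_lt h1
  · rw [Nat.mod_eq_sub_mod (by omega), Nat.mod_eq_of_lt (by omega)]

/-- Cutting the circle before position `0` turns a cyclic order of three points into one of three
linear orders. -/
theorem meets_iff (H : B.IsPosition N pos) {h k l : E × Bool} (hh : h.1 ∈ B.edges)
    (hk : k.1 ∈ B.edges) (hl : l.1 ∈ B.edges) (hhk : h ≠ k) (hkl : k ≠ l) (hhl : h ≠ l) :
    B.Meets h k l ↔ pos h < pos k ∧ pos k < pos l ∨ pos k < pos l ∧ pos l < pos h ∨
      pos l < pos h ∧ pos h < pos k := by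
  have h1 := H.lt h hh
  have h2 := H.lt k hk
  have h3 := H.lt l hl
  have d1 : pos h ≠ pos k := fun e => hhk (H.inj _ _ hh hk e)
  have d2 : pos k ≠ pos l := fun e => hkl (H.inj _ _ hk hl e)
  have d3 : pos h ≠ pos l := fun e => hhl (H.inj _ _ hh hl e)
  simp only [Meets, H.pow_next_eq_iff hh hk, ne_eq, H.pow_next_eq_iff hh hl]
  constructor
  · rintro ⟨j, hj, hjk, hjl⟩
    -- The right side is the number of steps from `h` to `l`; with `j` at least that large, `l`
    -- would be passed on the way.
    have hlt : j < (if pos h < pos l then pos l - pos h else pos l + N - pos h) := by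
      by_contra hcon
      refine hjl _ ?_ (not_lt.1 hcon) ?_
      · split_ifs <;> omega
      · rw [mod_of_lt_two_mul (by split_ifs <;> omega)]
        split_ifs <;> omega
    rw [mod_of_lt_two_mul (by split_ifs at hlt <;> omega)] at hjk
    split_ifs at hjk hlt <;> omega
  · intro hc
    refine ⟨if pos h < pos k then pos k - pos h else pos k + N - pos h, ?_, ?_, fun i hi hi' => ?_⟩
    · split_ifs <;> omega
    · rw [mod_of_lt_two_mul (by split_ifs <;> omega)]
      split_ifs <;> omega
    · rw [mod_of_lt_two_mul (by split_ifs at hi' <;> omega)]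
      split_ifs at hi' ⊢ <;> omega

/-- An inner equivalence says that a half-edge of `f` lies outside the interval bounded by those of
`e`; exactly one of the two does. This form is the parity of four comparisons, as needed in
`passes_add_passes`. -/
theorem interlaced_iff (H : B.IsPosition N pos) {e f : E} (he : e ∈ B.edges) (hf : f ∈ B.edges)
    (hef : e ≠ f) : B.Interlaced e f ↔
      ¬ ((pos (f, false) < pos (e, false) ↔ pos (f, false) < pos (e, true)) ↔
        (pos (f, true) < pos (e, false) ↔ pos (f, true) < pos (e, true))) := by
  have d : ∀ h k : E × Bool, h.1 ∈ B.edges → k.1 ∈ B.edges → h ≠ k → pos h ≠ pos k :=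
    fun h k hh hk hne e => hne (H.inj _ _ hh hk e)
  have d1 := d (e, false) (e, true) he he (by simp)
  have d2 := d (f, false) (f, true) hf hf (by simp)
  have d3 : ∀ i j, pos (e, i) ≠ pos (f, j) := fun i j => d _ _ he hf (by simp [hef])
  have m1 : ∀ i j, B.Meets (e, i) (f, j) (e, !i) ↔ _ := fun i j =>
    H.meets_iff he hf he (by simp [hef]) (by simp [hef.symm]) (by simp)
  have m2 : ∀ i j, B.Meets (f, j) (e, i) (f, !j) ↔ _ := fun i j =>
    H.meets_iff hf he hf (by simp [hef.symm]) (by simp [hef]) (by simp)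
  have m3 : ∀ i j, B.Meets (e, !i) (f, !j) (e, i) ↔ _ := fun i j =>
    H.meets_iff he hf he (by simp [hef]) (by simp [hef.symm]) (by simp)
  have m4 : ∀ i j, B.Meets (f, !j) (e, i) (f, j) ↔ _ := fun i j =>
    H.meets_iff hf he hf (by simp [hef.symm]) (by simp [hef]) (by simp)
  have m2' : ∀ i j, B.Meets (f, j) (e, !i) (f, !j) ↔ _ := fun i j => m2 (!i) j
  simp only [Interlaced, InCyclicOrder, m1, m2', m3, m4, Bool.exists_bool, Bool.not_true,
    Bool.not_false]
  have a1 := d3 false false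
  have a2 := d3 false true
  have a3 := d3 true false
  have a4 := d3 true true
  generalize pos (e, false) = p0 at *
  generalize pos (e, true) = p1 at *
  generalize pos (f, false) = q0 at *
  generalize pos (f, true) = q1 at *
  clear m1 m2 m3 m4 m2' d3 d H
  constructor
  · rintro ((⟨h, -, h', -⟩ | ⟨h, -, h', -⟩) | (⟨h, -, h', -⟩ | ⟨h, -, h', -⟩)) <;> omega
  · intro h
    rcases lt_or_gt_of_ne d1 with b1 | b1 <;> rcases lt_or_gt_of_ne d2 with b2 | b2 <;>
    rcases lt_or_gt_of_ne a1 with b3 | b3 <;> rcases lt_or_gt_of_ne a2 with b4 | b4 <;>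
    rcases lt_or_gt_of_ne a3 with b5 | b5 <;> rcases lt_or_gt_of_ne a4 with b6 | b6 <;>
    first
    | (exfalso; omega)
    | simp only [b1, b2, b3, b4, b5, b6, true_and, and_true, true_or, or_true]

end IsPosition

/-! ### Functions on boundary components -/

/-- Reduces well-definedness on boundary components to equations between explicit corners. -/
theorem forall_boundaryStep {G : RibbonGraph V E} {α : Type*} {φ : G.Corner → α}
    (arc : ∀ (h : E × Bool) (hh : h.1 ∈ G.edges),
      φ ⟨(h, true), hh⟩ = φ ⟨(G.next h, false), G.next_mem hh⟩)
    (untwisted : ∀ (e : E) (he : e ∈ G.edges) (i : Bool), ¬ G.Twisted e →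
      φ ⟨((e, false), i), he⟩ = φ ⟨((e, true), !i), he⟩)
    (twisted : ∀ (e : E) (he : e ∈ G.edges) (i : Bool), G.Twisted e →
      φ ⟨((e, false), i), he⟩ = φ ⟨((e, true), i), he⟩)
    (c d : G.Corner) (hcd : G.BoundaryStep c d) : φ c = φ d := by
  cases hcd with
  | arc hc hd =>
    obtain ⟨⟨h, i⟩, hh⟩ := c
    obtain ⟨d, hd'⟩ := d
    obtain rfl : i = true := hc
    obtain rfl : d = _ := hd
    exact arc h hh
  | untwisted e i he hc hd =>
    obtain ⟨c, hc'⟩ := c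
    obtain ⟨d, hd'⟩ := d
    obtain rfl : c = _ := hc
    obtain rfl : d = _ := hd
    exact untwisted e hc' i he
  | twisted e i he hc hd =>
    obtain ⟨c, hc'⟩ := c
    obtain ⟨d, hd'⟩ := d
    obtain rfl : c = _ := hc
    obtain rfl : d = _ := hd
    exact twisted e hc' i he

/-- The boundary component through a corner. -/
def boundaryOf (G : RibbonGraph V E) (c : (E × Bool) × Bool) (hc : c.1.1 ∈ G.edges) :
    Quot G.BoundaryStep := Quot.mk _ ⟨c, hc⟩

theorem boundaryOf_arc (G : RibbonGraph V E) (h : E × Bool) (hh : h.1 ∈ G.edges) :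
    G.boundaryOf (h, true) hh = G.boundaryOf (G.next h, false) (G.next_mem hh) :=
  Quot.sound (.arc _ _ rfl rfl)

theorem boundaryOf_untwisted (G : RibbonGraph V E) {e : E} (he : e ∈ G.edges) (i j : Bool)
    (ht : ¬ G.Twisted e) : G.boundaryOf ((e, i), j) he = G.boundaryOf ((e, !i), !j) he := by
  cases i
  · exact Quot.sound (.untwisted _ _ e j ht rfl rfl)
  · exact (Quot.sound (.untwisted _ _ e (!j) ht rfl (by simp))).symm

theorem boundaryOf_twisted (G : RibbonGraph V E) {e : E} (he : e ∈ G.edges) (i j : Bool)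
    (ht : G.Twisted e) : G.boundaryOf ((e, i), j) he = G.boundaryOf ((e, !i), j) he := by
  cases i
  · exact Quot.sound (.twisted _ _ e j ht rfl rfl)
  · exact (Quot.sound (.twisted _ _ e j ht rfl rfl)).symm

theorem finite_quot_boundaryStep (G : RibbonGraph V E) : Finite (Quot G.BoundaryStep) := by
  have : Finite G.Corner := by
    refine Finite.of_injective
      (fun c : G.Corner => ((⟨c.1.1.1, c.2⟩, c.1.1.2, c.1.2) : {e // e ∈ G.edges} × Bool × Bool)) ?_
    rintro ⟨⟨⟨a, b⟩, c⟩, h⟩ ⟨⟨⟨a', b'⟩, c'⟩, h'⟩ hh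
    simp only [Prod.mk.injEq, Subtype.mk.injEq] at hh
    obtain ⟨rfl, rfl, rfl⟩ := hh
    rfl
  exact Quot.finite _

/-! ### Colourings of the boundary of a bouquet -/

open Classical in
theorem signedIntersectionGraph_adj_apply (B : RibbonGraph V E) (e f : {e // e ∈ B.edges}) :
    B.signedIntersectionGraph.adj e f = (if B.intersectionGraph.Adj e f then 1 else 0) +
      if e = f then (if B.Twisted e.1 then 1 else 0) else 0 := by
  rw [SignedGraph.adj, Matrix.add_apply, SimpleGraph.adjMatrix_apply]
  congr 1
  by_cases h : e = f
  · rw [if_pos h]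
    exact if_pos h
  · rw [if_neg h]
    exact if_neg h

/-- The number mod 2 of half-edges of `e` that are passed on the way from the first half-edge of the
rotation to the corner `(h, i)`. -/
def passes (pos : E × Bool → ℕ) (e : E) (h : E × Bool) (i : Bool) : ZMod 2 :=
  ∑ j : Bool, if pos (e, j) < pos h ∨ (i = true ∧ pos (e, j) = pos h) then 1 else 0

/-- The colouring of the corners in which the two sides of the ribbon `e` differ by `x e`, and the
first corner has colour `0`. -/
def colour (B : RibbonGraph V E) (pos : E × Bool → ℕ) (x : {e // e ∈ B.edges} → ZMod 2)
    (h : E × Bool) (i : Bool) : ZMod 2 := ∑ e, passes pos e.1 h i * x e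

namespace IsPosition

variable {B : RibbonGraph V E} {N : ℕ} {pos : E × Bool → ℕ}

theorem pos_ne (H : B.IsPosition N pos) {h k : E × Bool} (hh : h.1 ∈ B.edges)
    (hk : k.1 ∈ B.edges) (hne : h ≠ k) : pos h ≠ pos k := fun e => hne (H.inj _ _ hh hk e)

/-- Between the two corners of `h` only the half-edge `h` itself is passed. -/
theorem colour_true (H : B.IsPosition N pos) (x : {e // e ∈ B.edges} → ZMod 2) {h : E × Bool}
    (hh : h.1 ∈ B.edges) : B.colour pos x h true = B.colour pos x h false + x ⟨h.1, hh⟩ := by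
  classical
  have key : ∀ e : {e // e ∈ B.edges}, passes pos e.1 h true =
      passes pos e.1 h false + if e = ⟨h.1, hh⟩ then 1 else 0 := by
    rintro ⟨e, he⟩
    obtain ⟨f, i⟩ := h
    by_cases hef : e = f
    · subst hef
      have := H.pos_ne (h := (e, false)) (k := (e, true)) he he (by simp)
      cases i <;> simp only [passes, Fintype.sum_bool, this, this.symm, true_and, or_true, or_false,
        if_true, Bool.false_eq_true, false_and, lt_irrefl, if_false] <;> ring
    · have h1 : ∀ j, pos (e, j) ≠ pos (f, i) := fun j => H.pos_ne he hh (by simp [hef])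
      simp [passes, h1, hef]
  simp only [colour, key, add_mul, Finset.sum_add_distrib, ite_mul, one_mul, zero_mul,
    Finset.sum_ite_eq', Finset.mem_univ, if_true]

/-- No half-edge lies on an arc of the disc. On the arc that closes the circle, both half-edges of
every edge have been passed, which is `0` mod 2 and agrees with the starting colour. -/
theorem colour_next (H : B.IsPosition N pos) (x : {e // e ∈ B.edges} → ZMod 2) {h : E × Bool}
    (hh : h.1 ∈ B.edges) : B.colour pos x (B.next h) false = B.colour pos x h true := by
  refine Finset.sum_congr rfl fun e _ => ?_
  congr 1
  have hlt := H.lt h hh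
  have hn := H.next h hh
  rcases Nat.lt_or_ge (pos h + 1) N with h1 | h1
  · rw [Nat.mod_eq_of_lt h1] at hn
    refine Finset.sum_congr rfl fun j _ => ?_
    refine if_congr ?_ rfl rfl
    simp only [hn, Bool.false_eq_true, false_and, or_false, true_and]
    omega
  · have h2 : pos h + 1 = N := by omega
    rw [h2, Nat.mod_self] at hn
    have h3 : ∀ j, pos (e.1, j) < pos h ∨ pos (e.1, j) = pos h := fun j => by
      have := H.lt (e.1, j) e.2
      omega
    simp only [passes, hn, not_lt_zero, Bool.false_eq_true, false_and, or_false, if_false,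
      true_and, h3, if_true, Fintype.sum_bool, add_zero]
    decide

open Classical in
-- For distinct loops the four comparisons add up to the parity in `interlaced_iff`. For a single
-- loop the sum is `1 + i + j`, reading `true` as `1`; free sides have `i = j` exactly for twisted
-- ribbons, which produces the diagonal of the matrix.
theorem passes_add_passes (H : B.IsPosition N pos) (e f : {e // e ∈ B.edges}) (i j : Bool) :
    passes pos f.1 (e.1, false) i + passes pos f.1 (e.1, true) j =
      (if B.intersectionGraph.Adj e f then 1 else 0) + if e = f ∧ i = j then 1 else 0 := by
  obtain ⟨e, he⟩ := e
  obtain ⟨f, hf⟩ := f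
  by_cases hef : e = f
  · subst hef
    have d := H.pos_ne (h := (e, false)) (k := (e, true)) he he (by simp)
    simp only [SimpleGraph.irrefl, if_false, true_and, zero_add, passes, Fintype.sum_bool]
    rcases lt_or_gt_of_ne d with d1 | d1 <;> cases i <;> cases j <;>
      simp [d1, d1.not_gt, d1.ne, d1.ne'] <;> decide
  · have d1 : ∀ i j, pos (f, i) ≠ pos (e, j) := fun i j =>
      H.pos_ne hf he (by simp [Ne.symm hef])
    have hadj : B.intersectionGraph.Adj ⟨e, he⟩ ⟨f, hf⟩ ↔ _ :=
      (show _ ↔ B.Interlaced e f from ⟨fun h => h.2, fun h => ⟨by simpa using hef, h⟩⟩).trans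
        (H.interlaced_iff he hf hef)
    simp only [hadj, Subtype.mk.injEq, hef, false_and, if_false, add_zero, passes,
      Fintype.sum_bool, d1, and_false, or_false]
    by_cases a1 : pos (f, false) < pos (e, false) <;> by_cases a2 : pos (f, false) < pos (e, true) <;>
    by_cases a3 : pos (f, true) < pos (e, false) <;> by_cases a4 : pos (f, true) < pos (e, true) <;>
    simp only [a1, a2, a3, a4, if_true, if_false, not_true, not_false_iff, iff_self, iff_true,
      iff_false] <;> decide

/-- The two corners are the ends of one free side, so the matrix measures the failure of the
colouring to be constant along it. -/
theorem colour_untwisted (H : B.IsPosition N pos) (x : {e // e ∈ B.edges} → ZMod 2)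
    (e : {e // e ∈ B.edges}) (i : Bool) (ht : ¬ B.Twisted e.1) :
    B.colour pos x (e.1, false) i + B.colour pos x (e.1, true) (!i) =
      B.signedIntersectionGraph.adj.mulVec x e := by
  classical
  rw [colour, colour, ← Finset.sum_add_distrib, Matrix.mulVec, dotProduct]
  refine Finset.sum_congr rfl fun f _ => ?_
  rw [← add_mul, H.passes_add_passes]
  congr 1
  simp [signedIntersectionGraph_adj_apply, ht]

theorem colour_twisted (H : B.IsPosition N pos) (x : {e // e ∈ B.edges} → ZMod 2)
    (e : {e // e ∈ B.edges}) (i : Bool) (ht : B.Twisted e.1) :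
    B.colour pos x (e.1, false) i + B.colour pos x (e.1, true) i =
      B.signedIntersectionGraph.adj.mulVec x e := by
  classical
  rw [colour, colour, ← Finset.sum_add_distrib, Matrix.mulVec, dotProduct]
  refine Finset.sum_congr rfl fun f _ => ?_
  rw [← add_mul, H.passes_add_passes]
  congr 1
  simp [signedIntersectionGraph_adj_apply, ht]

end IsPosition

/-- The mod 2 boundary map: for a function on the boundary components, the difference of its values
on the two sides of each ribbon. -/
def sideDiff (B : RibbonGraph V E) :
    (Quot B.BoundaryStep → ZMod 2) →ₗ[ZMod 2] ({e // e ∈ B.edges} → ZMod 2) where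
  toFun c e := c (B.boundaryOf ((e.1, false), false) e.2) + c (B.boundaryOf ((e.1, false), true) e.2)
  map_add' c d := by ext e; simp only [Pi.add_apply]; ring
  map_smul' t c := by ext e; simp [mul_add]

/-- The free sides carry the two values at `(e, false)` to `(e, true)`, in swapped roles if the
ribbon is untwisted; mod 2 the order does not affect the difference. -/
theorem sideDiff_eq (B : RibbonGraph V E) (c : Quot B.BoundaryStep → ZMod 2) {h : E × Bool}
    (hh : h.1 ∈ B.edges) : c (B.boundaryOf (h, true) hh) =
      c (B.boundaryOf (h, false) hh) + B.sideDiff c ⟨h.1, hh⟩ := by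
  have two : ∀ a b : ZMod 2, a = b + (b + a) := by decide
  have two' : ∀ a b : ZMod 2, a = b + (a + b) := by decide
  obtain ⟨e, i⟩ := h
  cases i
  · exact two _ _
  · by_cases ht : B.Twisted e
    · rw [B.boundaryOf_twisted hh _ _ ht, B.boundaryOf_twisted hh _ false ht]
      exact two _ _
    · rw [B.boundaryOf_untwisted hh _ _ ht, B.boundaryOf_untwisted hh _ false ht]
      exact two' _ _

/-- A colouring of the boundary components is determined by its side differences up to a constant. -/
theorem IsPosition.exists_eq_colour_add {B : RibbonGraph V E} {N : ℕ} {pos : E × Bool → ℕ}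
    (H : B.IsPosition N pos) (hB : B.IsBouquet) (c : Quot B.BoundaryStep → ZMod 2) :
    ∃ t, ∀ (h : E × Bool) (hh : h.1 ∈ B.edges) (i : Bool),
      c (B.boundaryOf (h, i) hh) = B.colour pos (B.sideDiff c) h i + t := by
  rcases B.edges.eq_empty_or_nonempty with hE | ⟨e₀, he₀⟩
  · exact ⟨0, fun h hh => by simp [hE] at hh⟩
  have two : ∀ a b d : ZMod 2, a + d + (b + d) = a + b := by decide
  have two' : ∀ a b : ZMod 2, a = b + (a + b) := by decide
  -- The discrepancy between `c` and the colouring rebuilt from its jumps. It changes neither across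
  -- a half-edge (`hD`) nor along an arc (`hN`), and the rotation is a single cycle.
  let D (h : E × Bool) (hh : h.1 ∈ B.edges) (i : Bool) :=
    c (B.boundaryOf (h, i) hh) + B.colour pos (B.sideDiff c) h i
  have hD : ∀ h hh, D h hh true = D h hh false := fun h hh => by
    simp only [D]
    rw [B.sideDiff_eq c, H.colour_true _ hh, two]
  have hN : ∀ h hh, D (B.next h) (B.next_mem hh) false = D h hh false := fun h hh => by
    rw [← hD h hh]
    simp only [D]
    rw [H.colour_next _ hh, B.boundaryOf_arc]
  obtain ⟨v, hv⟩ := Finset.card_eq_one.1 hB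
  have hinc : ∀ k : E × Bool, k.1 ∈ B.edges → B.inc k = v := fun k hk => by
    simpa [hv] using B.inc_mem k hk
  have hpow : ∀ (n : ℕ) (h : E × Bool) (hh : h.1 ∈ B.edges),
      D _ (B.pow_next_mem hh n) false = D h hh false := by
    intro n h hh
    induction n with
    | zero => rfl
    | succ n ih =>
      rw [← ih, ← hN _ (B.pow_next_mem hh n)]
      congr 1
      rw [pow_succ', Equiv.Perm.mul_apply]
  have hcongr : ∀ (h k : E × Bool) (hh : h.1 ∈ B.edges) (hk : k.1 ∈ B.edges), h = k →
      D h hh false = D k hk false := by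
    rintro h k hh hk rfl
    rfl
  refine ⟨D (e₀, false) he₀ false, fun h hh i => ?_⟩
  have h1 : D h hh false = D (e₀, false) he₀ false := by
    obtain ⟨i, hi⟩ := B.sameCycle_of_inc_eq (e₀, false) h he₀ hh
      ((hinc _ he₀).trans (hinc _ hh).symm)
    obtain ⟨n, rfl | rfl⟩ := i.eq_nat_or_neg
    · rw [← hpow n (e₀, false) he₀]
      exact hcongr _ _ _ _ (by simpa using hi.symm)
    · rw [← hpow n _ hh]
      exact hcongr _ _ _ _ (by rw [← hi]; simp)
  rw [← h1]
  cases i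
  · exact two' _ _
  · rw [← hD]; exact two' _ _

/-- A function on boundary components is, up to a constant, the colouring of its own jumps, and it
is constant along free sides, so the matrix kills the jumps. Conversely, if the matrix kills `x`,
the colouring of `x` descends to boundary components. -/
theorem IsPosition.range_sideDiff {B : RibbonGraph V E} {N : ℕ} {pos : E × Bool → ℕ}
    (H : B.IsPosition N pos) (hB : B.IsBouquet) :
    LinearMap.range B.sideDiff = LinearMap.ker B.signedIntersectionGraph.adj.mulVecLin := by
  have add_self : ∀ a b : ZMod 2, a = b → a + b = 0 := by decide
  have eq_of_add : ∀ a b : ZMod 2, a + b = 0 → a = b := by decide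
  have two : ∀ a b d : ZMod 2, a + d = b + d → a + b = 0 := by decide
  ext x
  rw [LinearMap.mem_range, LinearMap.mem_ker, Matrix.mulVecLin_apply]
  constructor
  · rintro ⟨c, rfl⟩
    obtain ⟨t, ht⟩ := H.exists_eq_colour_add hB c
    ext e
    by_cases htw : B.Twisted e.1
    · rw [← H.colour_twisted _ e true htw]
      refine two _ _ t ?_
      rw [← ht _ e.2, ← ht _ e.2]
      exact congrArg c (B.boundaryOf_twisted e.2 _ _ htw)
    · rw [← H.colour_untwisted _ e true htw]
      refine two _ _ t ?_
      rw [← ht _ e.2, ← ht _ e.2]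
      exact congrArg c (B.boundaryOf_untwisted e.2 _ _ htw)
  · intro hx
    have hx' : ∀ e, B.signedIntersectionGraph.adj.mulVec x e = 0 := fun e => by rw [hx]; rfl
    refine ⟨Quot.lift (fun c : B.Corner => B.colour pos x c.1.1 c.1.2)
      (forall_boundaryStep (fun h hh => (H.colour_next x hh).symm)
        (fun e he i ht => ?_) (fun e he i ht => ?_)), ?_⟩
    · exact eq_of_add _ _ ((H.colour_untwisted x ⟨e, he⟩ i ht).trans (hx' _))
    · exact eq_of_add _ _ ((H.colour_twisted x ⟨e, he⟩ i ht).trans (hx' _))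
    · ext e
      change B.colour pos x (e.1, false) false + B.colour pos x (e.1, false) true = x e
      rw [H.colour_true x e.2, ← add_assoc, add_self _ _ rfl, zero_add]

theorem IsPosition.ker_sideDiff {B : RibbonGraph V E} {N : ℕ} {pos : E × Bool → ℕ}
    (H : B.IsPosition N pos) (hB : B.IsBouquet) :
    LinearMap.ker B.sideDiff = Submodule.span (ZMod 2) {1} := by
  ext c
  rw [LinearMap.mem_ker, Submodule.mem_span_singleton]
  constructor
  · intro hc
    obtain ⟨t, ht⟩ := H.exists_eq_colour_add hB c
    refine ⟨t, ?_⟩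
    ext q
    induction q using Quot.ind with
    | mk a =>
      refine Eq.trans ?_ (ht a.1.1 a.2 a.1.2).symm
      simp [hc, colour]
  · rintro ⟨t, rfl⟩
    ext e
    exact CharTwo.add_self_eq_zero _

/-- The number of boundary components of a bouquet with at least one loop. -/
theorem IsBouquet.card_quot_boundaryStep {B : RibbonGraph V E} (hB : B.IsBouquet)
    (hE : B.edges.Nonempty) : Nat.card (Quot B.BoundaryStep) +
      B.signedIntersectionGraph.adj.rank = B.edges.card + 1 := by
  obtain ⟨e, he⟩ := hE
  obtain ⟨N, pos, H⟩ := hB.exists_isPosition (h₀ := (e, false)) he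
  have := B.finite_quot_boundaryStep
  have := Fintype.ofFinite (Quot B.BoundaryStep)
  have h1 := LinearMap.finrank_range_add_finrank_ker B.sideDiff
  have h2 := LinearMap.finrank_range_add_finrank_ker B.signedIntersectionGraph.adj.mulVecLin
  -- A loop provides a boundary component in the quotient, so the constants form a line.
  have hone : (1 : Quot B.BoundaryStep → ZMod 2) ≠ 0 := fun h =>
    one_ne_zero (congrFun h (B.boundaryOf ((e, false), false) he))
  rw [H.range_sideDiff hB, H.ker_sideDiff hB, finrank_span_singleton hone,
    Module.finrank_fintype_fun_eq_card] at h1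
  rw [Module.finrank_fintype_fun_eq_card, Fintype.card_coe] at h2
  rw [Nat.card_eq_fintype_card, Matrix.rank]
  omega

theorem card_face_of_forall_exists_inc_eq {G : RibbonGraph V E}
    (h : ∀ v ∈ G.verts, ∃ k : E × Bool, k.1 ∈ G.edges ∧ G.inc k = v) :
    Nat.card G.Face = Nat.card (Quot G.BoundaryStep) := by
  have : IsEmpty {v // v ∈ G.verts ∧ ∀ h : E × Bool, h.1 ∈ G.edges → G.inc h ≠ v} :=
    ⟨fun ⟨v, hv, hv'⟩ => by
      obtain ⟨k, hk, hkv⟩ := h v hv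
      exact hv' k hk hkv⟩
  exact Nat.card_congr (Equiv.sumEmpty _ _)

theorem card_face_of_edges_eq_empty {G : RibbonGraph V E} (h : G.edges = ∅) :
    Nat.card G.Face = G.verts.card := by
  have : IsEmpty (Quot G.BoundaryStep) :=
    ⟨fun q => Quot.ind (β := fun _ => False) (fun c => by have := c.2; simp [h] at this) q⟩
  rw [Face, Nat.card_congr (Equiv.emptySum _ _)]
  simp [h]

/-- The number of faces of a bouquet. -/
theorem IsBouquet.card_face {B : RibbonGraph V E} (hB : B.IsBouquet) :
    Nat.card B.Face + B.signedIntersectionGraph.adj.rank = B.edges.card + 1 := by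
  rcases B.edges.eq_empty_or_nonempty with hE | hE
  -- Without loops the surface is a disc with one boundary circle, and the matrix is empty.
  · have := B.signedIntersectionGraph.adj.rank_le_card_width
    have hE' : B.edges.card = 0 := by rw [hE, Finset.card_empty]
    rw [Fintype.card_coe] at this
    rw [card_face_of_edges_eq_empty hE, hB]
    omega
  · rw [card_face_of_forall_exists_inc_eq, hB.card_quot_boundaryStep hE]
    intro v hv
    obtain ⟨e, he⟩ := hE
    refine ⟨(e, false), he, ?_⟩
    exact Finset.card_le_one.1 hB.le _ (B.inc_mem (e, false) he) _ hv

/-! ### Connectedness -/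

/-- Connectedness as induction over vertices: contraction then only requires pulling back a
predicate, without transporting walks. -/
theorem connected_simpleGraph_iff {G : RibbonGraph V E} {S : Finset E} (hS : S ⊆ G.edges) :
    (G.simpleGraph S).Connected ↔ G.verts.Nonempty ∧ ∀ P : V → Prop,
      (∀ e ∈ S, P (G.inc (e, false)) ↔ P (G.inc (e, true))) →
        (∃ v ∈ G.verts, P v) → ∀ u ∈ G.verts, P u := by
  constructor
  · intro hc
    have hp := hc.preconnected
    obtain ⟨v₀⟩ := hc.nonempty
    refine ⟨⟨v₀.1, v₀.2⟩, fun P hP ⟨v, hv, hPv⟩ u hu => ?_⟩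
    obtain ⟨w⟩ := hp ⟨v, hv⟩ ⟨u, hu⟩
    have key : ∀ a b : {v // v ∈ G.verts}, (G.simpleGraph S).Walk a b → P a.1 → P b.1 := by
      intro a b w
      induction w with
      | nil => exact id
      | cons hadj _ ih =>
        intro ha
        apply ih
        rw [simpleGraph, SimpleGraph.fromRel_adj] at hadj
        rcases hadj.2 with ⟨e, he, h⟩ | ⟨e, he, h⟩ <;>
        rcases Sym2.eq_iff.1 h with ⟨h1, h2⟩ | ⟨h1, h2⟩ <;>
        have h3 := hP e he <;> rw [h1, h2] at h3 <;> tauto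
    exact key _ _ w hPv
  · rintro ⟨⟨v₀, hv₀⟩, h⟩
    have : Nonempty {v // v ∈ G.verts} := ⟨⟨v₀, hv₀⟩⟩
    refine SimpleGraph.Connected.mk fun v u => ?_
    have hr := h (fun u => ∃ hu : u ∈ G.verts, (G.simpleGraph S).Reachable v ⟨u, hu⟩)
      ?_ ⟨v.1, v.2, v.2, SimpleGraph.Reachable.refl _⟩ u.1 u.2
    · exact hr.2
    · intro e he
      have h0 := G.inc_mem (e, false) (hS he)
      have h1 := G.inc_mem (e, true) (hS he)
      have hr : (G.simpleGraph S).Reachable ⟨_, h0⟩ ⟨_, h1⟩ := by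
        by_cases heq : G.inc (e, false) = G.inc (e, true)
        · simp only [heq]
          exact SimpleGraph.Reachable.refl _
        · refine SimpleGraph.Adj.reachable ?_
          rw [simpleGraph, SimpleGraph.fromRel_adj]
          exact ⟨by simpa using heq, Or.inl ⟨e, he, rfl⟩⟩
      exact ⟨fun ⟨_, h⟩ => ⟨h1, h.trans hr⟩, fun ⟨_, h⟩ => ⟨h0, h.trans hr.symm⟩⟩

theorem connected_simpleGraph_mono {G : RibbonGraph V E} {S T : Finset E} (hST : S ⊆ T)
    (h : (G.simpleGraph S).Connected) : (G.simpleGraph T).Connected := by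
  refine h.mono fun u v huv => ?_
  rw [simpleGraph, SimpleGraph.fromRel_adj] at huv ⊢
  exact ⟨huv.1, huv.2.imp (fun ⟨e, he, h⟩ => ⟨e, hST he, h⟩) (fun ⟨e, he, h⟩ => ⟨e, hST he, h⟩)⟩

theorem image_edgeSet_simpleGraph {G : RibbonGraph V E} {S : Finset E} (hS : S ⊆ G.edges) :
    Set.image (Sym2.map Subtype.val) (G.simpleGraph S).edgeSet =
      Set.image G.ends {e | e ∈ S ∧ ¬ (G.ends e).IsDiag} := by
  ext z
  constructor
  · rintro ⟨y, hy, rfl⟩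
    induction y using Sym2.ind with
    | _ u v =>
      rw [SimpleGraph.mem_edgeSet, simpleGraph, SimpleGraph.fromRel_adj] at hy
      have hne : u.1 ≠ v.1 := fun h => hy.1 (Subtype.ext h)
      rcases hy.2 with ⟨e, he, h⟩ | ⟨e, he, h⟩
      · exact ⟨e, ⟨he, by rw [h]; simpa using hne⟩, by rw [h]; rfl⟩
      · exact ⟨e, ⟨he, by rw [h]; simpa using hne.symm⟩, by rw [h, Sym2.eq_swap]; rfl⟩
  · rintro ⟨e, ⟨he, hd⟩, rfl⟩
    refine ⟨s(⟨_, G.inc_mem (e, false) (hS he)⟩, ⟨_, G.inc_mem (e, true) (hS he)⟩), ?_, rfl⟩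
    rw [SimpleGraph.mem_edgeSet, simpleGraph, SimpleGraph.fromRel_adj]
    exact ⟨by simpa [ends] using hd, Or.inl ⟨e, he, rfl⟩⟩

theorem card_edgeSet_simpleGraph {G : RibbonGraph V E} {S : Finset E} (hS : S ⊆ G.edges) :
    Nat.card (G.simpleGraph S).edgeSet = (Set.image G.ends {e | e ∈ S ∧ ¬ (G.ends e).IsDiag}).ncard := by
  rw [← image_edgeSet_simpleGraph hS,
    Set.ncard_image_of_injective _ (Sym2.map.injective Subtype.val_injective)]
  rfl

/-- A connected simple graph on `n` vertices has at least `n - 1` edges, and discarding loops and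
identifying parallels can only lower the count of `S`. -/
theorem card_verts_le {G : RibbonGraph V E} {S : Finset E} (hS : S ⊆ G.edges)
    (h : (G.simpleGraph S).Connected) : G.verts.card ≤ S.card + 1 := by
  have h1 := h.card_vert_le_card_edgeSet_add_one
  rw [card_edgeSet_simpleGraph hS, Nat.card_eq_fintype_card, Fintype.card_coe] at h1
  have h2 : (Set.image G.ends {e | e ∈ S ∧ ¬ (G.ends e).IsDiag}).ncard ≤ S.card := by
    refine (Set.ncard_image_le (S.finite_toSet.subset fun e he => he.1)).trans ?_
    rw [← Set.ncard_coe_finset]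
    exact Set.ncard_le_ncard (fun e he => he.1) S.finite_toSet
  omega

theorem IsSpanningTree.card_verts {G : RibbonGraph V E} {T : Finset E} (hT : G.IsSpanningTree T) :
    G.verts.card = T.card + 1 := by
  classical
  have h1 := hT.isTree.card_edgeFinset
  have h2 := card_edgeSet_simpleGraph hT.subset
  have h3 : {e | e ∈ T ∧ ¬ (G.ends e).IsDiag} = (T : Set E) := by
    ext e
    exact ⟨fun h => h.1, fun h => ⟨h, hT.not_loop e h⟩⟩
  rw [h3, hT.not_parallel.ncard_image, Set.ncard_coe_finset,
    Nat.card_eq_fintype_card, ← SimpleGraph.edgeFinset_card] at h2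
  rw [Fintype.card_coe] at h1
  omega

theorem Connected.numComponents {G : RibbonGraph V E} (h : G.Connected) : G.numComponents = 1 := by
  have := h.preconnected.subsingleton_connectedComponent
  have := h.nonempty
  exact Nat.card_unique

/-- In a connected ribbon graph with an edge, every vertex carries a half-edge. -/
theorem Connected.card_face {G : RibbonGraph V E} (h : G.Connected) (hE : G.edges.Nonempty) :
    Nat.card G.Face = Nat.card (Quot G.BoundaryStep) := by
  obtain ⟨e, he⟩ := hE
  -- Carrying a half-edge holds at both ends of every edge, so it spreads over the connected graph.
  refine card_face_of_forall_exists_inc_eq (((connected_simpleGraph_iff subset_rfl).1 h).2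
    (fun v => ∃ k : E × Bool, k.1 ∈ G.edges ∧ G.inc k = v) (fun f hf => ?_)
    ⟨_, G.inc_mem (e, false) he, (e, false), he, rfl⟩)
  exact iff_of_true ⟨_, hf, rfl⟩ ⟨_, hf, rfl⟩

/-! ### The rotation after merging two vertex-discs -/

theorem eq_other_of_ne {e : E} {h : E × Bool} {i : Bool} (he : h.1 = e) (hi : h ≠ (e, i)) :
    h = (e, !i) := by
  refine Prod.ext he (Bool.eq_not_of_ne fun h' => hi (Prod.ext he h'))

theorem next_ne_other {G : RibbonGraph V E} {e : E}
    (hne : G.inc (e, false) ≠ G.inc (e, true)) (i : Bool) :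
    G.next (e, i) ≠ (e, !i) := by
  intro h
  have := G.inc_next (e, i)
  rw [h] at this
  cases i
  · exact hne this.symm
  · exact hne this

theorem mergeNext_of_ne [DecidableEq E] {G : RibbonGraph V E} {e : E} {h : E × Bool}
    (hh : h.1 ≠ e) (hn : (G.next h).1 ≠ e) :
    mergeNext G e h = G.next h := by
  have h1 : ∀ i, h ≠ (e, i) := fun i hi => hh (by rw [hi])
  have h2 : ∀ i, G.next h ≠ (e, i) := fun i hi => hn (by rw [hi])
  have h3 : (G.next * Equiv.swap (e, false) (e, true)) h = G.next h := by
    rw [Equiv.Perm.mul_apply, Equiv.swap_apply_of_ne_of_ne (h1 _) (h1 _)]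
  have h4 : removePoint (G.next * Equiv.swap (e, false) (e, true)) (e, false) h = G.next h := by
    rw [removePoint_of_ne (h1 _) (by rw [h3]; exact h2 _), h3]
  rw [mergeNext, removePoint_of_ne (h1 _) (by rw [h4]; exact h2 _), h4]

/-- Here `h` is the last entry of `A` in `(e A)`. In `(A B)` it is followed by the first entry of
`B`, or by the first entry of `A` when `B` is empty. -/
theorem mergeNext_of_next_eq [DecidableEq E] {G : RibbonGraph V E} {e : E}
    (hne : G.inc (e, false) ≠ G.inc (e, true)) {h : E × Bool} {i : Bool}
    (hh : h.1 ≠ e) (hn : G.next h = (e, i)) :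
    mergeNext G e h =
      if G.next (e, !i) = (e, !i) then G.next (e, i) else G.next (e, !i) := by
  have h1 : ∀ i, h ≠ (e, i) := fun i hi => hh (by rw [hi])
  have hi : G.next (e, i) ≠ (e, i) := fun h' => h1 i (G.next.injective (hn.trans h'.symm))
  have hf := next_ne_other hne false
  have ht := next_ne_other hne true
  simp only [Bool.not_false, Bool.not_true] at hf ht
  cases i
  · by_cases hfix : G.next (e, true) = (e, true) <;>
    simp [mergeNext, removePoint, Equiv.swap_apply_def, h1, hn, hf, hi, hfix]
  · by_cases hfix : G.next (e, false) = (e, false) <;>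
    simp [mergeNext, removePoint, Equiv.swap_apply_def, h1, hn, hi.symm, hfix]

/-! ### Reversing a vertex-disc -/

/-- Used once in each direction, this gives equality of the counts without checking that two maps
are inverse. -/
theorem card_quot_le_of_surjective {G G' : RibbonGraph V E} (f : G.Corner → Quot G'.BoundaryStep)
    (hf : ∀ c d, G.BoundaryStep c d → f c = f d) (hs : ∀ c : G'.Corner, ∃ d, f d = Quot.mk _ c) :
    Nat.card (Quot G'.BoundaryStep) ≤ Nat.card (Quot G.BoundaryStep) := by
  have := G.finite_quot_boundaryStep
  refine Nat.card_le_card_of_surjective (Quot.lift f hf) fun q => ?_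
  induction q using Quot.ind with
  | mk c =>
    obtain ⟨d, hd⟩ := hs c
    exact ⟨Quot.mk _ d, hd⟩

variable [DecidableEq V]

theorem flip_flip (G : RibbonGraph V E) (v : V) : (G.flip v).flip v = G := by
  obtain ⟨_, _, inc, next, sign, _, _, inc_next, _⟩ := G
  simp only [flip, mk.injEq, true_and]
  constructor
  · ext h : 1
    change (if inc h = v then (if inc h = v then next h else next.symm h)
      else (if inc h = v then next.symm h else next h)) = next h
    by_cases hv : inc h = v <;> simp [hv]
  · ext h : 1
    by_cases hv : inc h = v <;> simp [hv]

theorem flip_next_of_eq (G : RibbonGraph V E) {v : V} {h : E × Bool} (hv : G.inc h = v) :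
    (G.flip v).next h = G.next.symm h := if_pos hv

theorem flip_next_of_ne (G : RibbonGraph V E) {v : V} {h : E × Bool} (hv : G.inc h ≠ v) :
    (G.flip v).next h = G.next h := if_neg hv

/-- Each end of `e` at `v` changes one sign, so twistedness changes exactly when one end but not the
other lies at `v`. -/
theorem flip_twisted_iff (G : RibbonGraph V E) (v : V) (e : E) :
    (G.flip v).Twisted e ↔
      (G.Twisted e ↔ (G.inc (e, false) = v ↔ G.inc (e, true) = v)) := by
  have key : ∀ a b : ℤˣ, (-a ≠ b ↔ ¬ a ≠ b) ∧ (a ≠ -b ↔ ¬ a ≠ b) ∧ (-a ≠ -b ↔ a ≠ b) := by decide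
  obtain ⟨k1, k2, k3⟩ := key (G.sign (e, false)) (G.sign (e, true))
  unfold Twisted
  by_cases h0 : G.inc (e, false) = v <;> by_cases h1 : G.inc (e, true) = v
  all_goals
    simp only [flip, h0, h1, if_true, if_false, iff_self, iff_true, iff_false, not_true]
    try first | exact k1 | exact k2 | exact k3 | exact Iff.rfl

/-- The side of a half-edge after reversing the vertex-disc `v`. -/
def flipSide (G : RibbonGraph V E) (v : V) (h : E × Bool) (i : Bool) : Bool :=
  if G.inc h = v then !i else i

/-- The surface is unchanged; only the names of the two corners of each half-edge at `v` are
exchanged. Since `flip` is an involution, the inequality suffices. -/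
theorem card_quot_flip_le (G : RibbonGraph V E) (v : V) :
    Nat.card (Quot (G.flip v).BoundaryStep) ≤ Nat.card (Quot G.BoundaryStep) := by
  refine card_quot_le_of_surjective
    (fun c => (G.flip v).boundaryOf (c.1.1, G.flipSide v c.1.1 c.1.2) c.2)
    (forall_boundaryStep (fun h hh => ?_) (fun e he i ht => ?_) (fun e he i ht => ?_)) fun c => ?_
  · by_cases hv : G.inc h = v
    · have hv' : G.inc (G.next h) = v := (G.inc_next h).trans hv
      have := (G.flip v).boundaryOf_arc (G.next h) (G.next_mem hh)
      simp only [G.flip_next_of_eq hv', Equiv.symm_apply_apply] at this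
      simp only [flipSide, hv, hv', if_true, Bool.not_true, Bool.not_false]
      exact this.symm
    · have hv' : G.inc (G.next h) ≠ v := fun h' => hv ((G.inc_next h).symm.trans h')
      have := (G.flip v).boundaryOf_arc h hh
      simp only [G.flip_next_of_ne hv] at this
      simp only [flipSide, hv, hv', if_false]
      exact this
  iterate 2
    have hiff := G.flip_twisted_iff v e
    simp only [ht, true_iff, false_iff] at hiff
    by_cases h0 : G.inc (e, false) = v <;> by_cases h1 : G.inc (e, true) = v <;>
    simp only [h0, h1, iff_self, not_true, iff_false, iff_true, not_false_iff] at hiff <;>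
    simp only [flipSide, h0, h1, if_true, if_false, Bool.not_not] <;>
    first
    | exact (G.flip v).boundaryOf_twisted he false _ hiff
    | exact (G.flip v).boundaryOf_untwisted he false _ hiff
    | simpa only [Bool.not_not, Bool.not_false] using
        (G.flip v).boundaryOf_untwisted he false (!i) hiff
  · obtain ⟨⟨h, i⟩, hc⟩ := c
    refine ⟨⟨(h, G.flipSide v h i), hc⟩, ?_⟩
    have : G.flipSide v h (G.flipSide v h i) = i := by
      by_cases hv : G.inc h = v <;> simp [flipSide, hv]
    simp only [this]
    rfl

theorem card_quot_flip (G : RibbonGraph V E) (v : V) :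
    Nat.card (Quot (G.flip v).BoundaryStep) = Nat.card (Quot G.BoundaryStep) := by
  refine le_antisymm (G.card_quot_flip_le v) ?_
  have := (G.flip v).card_quot_flip_le v
  rwa [flip_flip] at this

theorem card_face_flip (G : RibbonGraph V E) (v : V) :
    Nat.card (G.flip v).Face = Nat.card G.Face := by
  have := G.finite_quot_boundaryStep
  have := (G.flip v).finite_quot_boundaryStep
  have e := Classical.choice (Finite.card_eq.1 (G.card_quot_flip v))
  exact Nat.card_congr (e.sumCongr (Equiv.refl _))

theorem eulerGenus_flip (G : RibbonGraph V E) (v : V) : (G.flip v).eulerGenus = G.eulerGenus := by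
  rw [eulerGenus, eulerGenus, eulerChar, eulerChar, card_face_flip]
  rfl

/-! ### Merging two vertex-discs -/

variable [DecidableEq E]

section Merge

variable {G : RibbonGraph V E} {e : E} (he : e ∈ G.edges)
  (hne : G.inc (e, false) ≠ G.inc (e, true))

/-- Two discs joined by an untwisted ribbon form a disc, and the two sides of the ribbon are
absorbed into its boundary arcs. `hfix` excludes that the new disc carries no half-edge, since its
boundary would then have no corner. -/
theorem card_quot_merge (ht : ¬ G.Twisted e)
    (hfix : ∃ i, G.next (e, i) ≠ (e, i)) :
    Nat.card (Quot (G.merge e he hne).BoundaryStep) = Nat.card (Quot G.BoundaryStep) := by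
  set G' := G.merge e he hne
  have hnext : ∀ h, G'.next h = G.mergeNext e h := fun _ => rfl
  have hmem : ∀ {f : E}, f ∈ G'.edges ↔ f ≠ e ∧ f ∈ G.edges := Finset.mem_erase
  have ne_of : ∀ {h : E × Bool}, h.1 ≠ e → ∀ i, h ≠ (e, i) := fun hh i hi => hh (by rw [hi])
  -- `p i` is the half-edge before `(e, i)`, and `r i` the one before that place after merging
  obtain ⟨p, hp⟩ : ∃ p : Bool → E × Bool, ∀ i, G.next (p i) = (e, i) :=
    ⟨fun i => G.next.symm (e, i), fun i => by simp⟩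
  have hpe : ∀ i, p i ≠ (e, i) → (p i).1 ≠ e := by
    rintro i hi h
    have h1 : p i = (e, !i) := eq_other_of_ne h hi
    have h2 := hp i
    rw [h1] at h2
    exact next_ne_other hne (!i) (by rw [h2, Bool.not_not])
  have hpm : ∀ i, (p i).1 ∈ G.edges := by
    intro i
    by_contra hcon
    have := G.next_of_notMem _ hcon
    rw [hp] at this
    rw [← this] at hcon
    exact hcon he
  have hpfix : ∀ i, p i = (e, i) ↔ G.next (e, i) = (e, i) := fun i =>
    ⟨fun h => by have := hp i; rwa [h] at this, fun h => G.next.injective ((hp i).trans h.symm)⟩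
  have hfix' : ∀ i, p i = (e, i) → p (!i) ≠ (e, !i) := by
    obtain ⟨j, hj⟩ := hfix
    intro i h h'
    rw [hpfix] at h h'
    cases i <;> cases j <;> simp_all
  obtain ⟨r, hr⟩ : ∃ r : Bool → E × Bool, ∀ i, r i = if p i = (e, i) then p (!i) else p i :=
    ⟨_, fun _ => rfl⟩
  have hre : ∀ i, (r i).1 ∈ G'.edges := by
    intro i
    rw [hmem, hr]
    split_ifs with h
    · exact ⟨hpe _ (hfix' i h), hpm _⟩
    · exact ⟨hpe _ h, hpm _⟩
  -- `r1`, `r2`, `r3` treat the arcs running into an end of `e`, out of an end, and from an end back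
  -- to itself.
  have r1 : ∀ i h, h.1 ≠ e → G.next h = (e, i) → r i = h := by
    intro i h hh hn
    have : p i = h := G.next.injective ((hp i).trans hn.symm)
    rw [hr, if_neg (by rw [this]; exact ne_of hh i), this]
  have r2 : ∀ i, G.next (e, i) ≠ (e, i) → G'.next (r (!i)) = G.next (e, i) := by
    intro i hi
    rw [hnext, hr, Bool.not_not]
    split_ifs with h
    · rw [mergeNext_of_next_eq hne (hpe i (by rwa [Ne, hpfix])) (hp i), if_pos ((hpfix _).1 h)]
    · rw [mergeNext_of_next_eq hne (hpe _ h) (hp _), Bool.not_not, if_neg hi]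
  have r3 : ∀ i, G.next (e, i) = (e, i) → r i = r (!i) := by
    intro i hi
    rw [← hpfix] at hi
    rw [hr, hr, if_pos hi, if_neg (hfix' i hi)]
  have congr_bd : ∀ {c d : (E × Bool) × Bool} (hc : c.1.1 ∈ G'.edges) (hd : d.1.1 ∈ G'.edges),
      c = d → G'.boundaryOf c hc = G'.boundaryOf d hd := by
    rintro c d hc hd rfl
    rfl
  apply le_antisymm
  -- The side of `e` through `((e, i), false)` and `((e, !i), true)` has index `i`, the `xor` at
  -- both corners. It goes to the boundary component that leaves `r i`.
  · let φ : G.Corner → Quot G'.BoundaryStep := fun c =>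
      if h : c.1.1.1 ≠ e then G'.boundaryOf c.1 (hmem.2 ⟨h, c.2⟩)
      else G'.boundaryOf (r (xor c.1.1.2 c.1.2), true) (hre _)
    have φ1 : ∀ (h : E × Bool) (i : Bool) (hh : h.1 ∈ G.edges) (hhe : h.1 ≠ e),
        φ ⟨(h, i), hh⟩ = G'.boundaryOf (h, i) (hmem.2 ⟨hhe, hh⟩) :=
      fun h i hh hhe => dif_pos hhe
    have φ2 : ∀ (h : E × Bool) (i j : Bool) (hh : h.1 ∈ G.edges) (hhe : h = (e, i)),
        φ ⟨(h, j), hh⟩ = G'.boundaryOf (r (xor i j), true) (hre _) := by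
      rintro h i j hh rfl
      exact dif_neg (fun h => h rfl)
    refine card_quot_le_of_surjective φ (forall_boundaryStep (fun h hh => ?_)
      (fun f hf i htf => ?_) (fun f hf i htf => ?_)) fun c => ?_
    · by_cases hhe : h.1 = e
      · obtain ⟨f, i⟩ := h
        obtain rfl : f = e := hhe
        rw [φ2 (f, i) i true hh rfl]
        by_cases hi : G.next (f, i) = (f, i)
        · rw [φ2 _ i false _ hi]
          exact congr_bd _ _ (by rw [Bool.xor_true, Bool.xor_false, r3 i hi])
        · have hi' : (G.next (f, i)).1 ≠ f := by
            intro h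
            exact next_ne_other hne i (eq_other_of_ne h hi)
          rw [φ1 _ _ _ hi', G'.boundaryOf_arc _ (hre _)]
          exact congr_bd _ _ (by simp [r2 i hi])
      · rw [φ1 _ _ _ hhe]
        by_cases hn : (G.next h).1 = e
        · have hn' : G.next h = (e, (G.next h).2) := Prod.ext hn rfl
          rw [φ2 _ _ false _ hn']
          exact congr_bd _ _ (by rw [Bool.xor_false, r1 _ h hhe hn'])
        · rw [φ1 _ _ _ hn, G'.boundaryOf_arc]
          exact congr_bd _ _ (by rw [hnext, mergeNext_of_ne hhe hn])
    · by_cases hfe : f = e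
      · subst hfe
        rw [φ2 _ false i _ rfl, φ2 _ true (!i) _ rfl]
        exact congr_bd _ _ (by simp)
      · rw [φ1 _ _ _ hfe, φ1 _ _ _ hfe]
        exact G'.boundaryOf_untwisted _ false i htf
    · have hfe : f ≠ e := by
        rintro rfl
        exact ht htf
      rw [φ1 _ _ _ hfe, φ1 _ _ _ hfe]
      exact G'.boundaryOf_twisted _ false i htf
    · exact ⟨⟨c.1, (hmem.1 c.2).2⟩, φ1 _ _ _ (hmem.1 c.2).1⟩
  · have congr_bd' : ∀ {c d : (E × Bool) × Bool} (hc : c.1.1 ∈ G.edges) (hd : d.1.1 ∈ G.edges),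
        c = d → G.boundaryOf c hc = G.boundaryOf d hd := by
      rintro c d hc hd rfl
      rfl
    have s1 : ∀ i, G.boundaryOf ((e, i), true) he = G.boundaryOf ((e, !i), false) he := fun i =>
      G.boundaryOf_untwisted he i true ht
    have s1' : ∀ i, G.boundaryOf ((e, !i), true) he = G.boundaryOf ((e, i), false) he := fun i =>
      (s1 (!i)).trans (congr_bd' _ _ (by rw [Bool.not_not]))
    have s2 : ∀ i, G.boundaryOf (p i, true) (hpm i) = G.boundaryOf ((e, i), false) he := fun i =>
      (G.boundaryOf_arc _ _).trans (congr_bd' _ _ (by rw [hp]))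
    have s3 : ∀ i, G.boundaryOf (r i, true) (hmem.1 (hre i)).2 = G.boundaryOf ((e, i), false) he := by
      intro i
      by_cases h : p i = (e, i)
      · rw [congr_bd' (d := (p (!i), true)) _ (hpm _) (by rw [hr, if_pos h]), s2, ← s1, ← s2]
        exact congr_bd' _ _ (by rw [h])
      · rw [congr_bd' (d := (p i, true)) _ (hpm _) (by rw [hr, if_neg h]), s2]
    refine card_quot_le_of_surjective (fun c => G.boundaryOf c.1 (hmem.1 c.2).2)
      (forall_boundaryStep (fun h hh => ?_) (fun f hf i htf => ?_) (fun f hf i htf => ?_))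
      fun c => ?_
    · obtain ⟨hhe, hhm⟩ := hmem.1 hh
      by_cases hn : (G.next h).1 = e
      · have hn' : G.next h = (e, (G.next h).2) := Prod.ext hn rfl
        set i := (G.next h).2
        have hm := mergeNext_of_next_eq hne hhe hn'
        have h1 : G.boundaryOf (h, true) hhm = G.boundaryOf ((e, i), false) he :=
          (G.boundaryOf_arc h hhm).trans (congr_bd' _ _ (by rw [hn']))
        refine h1.trans ?_
        -- In `G` the merged arc runs from `h` to `e` and along one side of the ribbon; if the other
        -- disc has no further half-edge, it goes round that disc and returns along the other side.
        by_cases hfx : G.next (e, !i) = (e, !i)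
        · rw [if_pos hfx] at hm
          rw [← s1', G.boundaryOf_arc _ he,
            congr_bd' (d := ((e, !i), false)) _ he (by rw [hfx]), ← s1, G.boundaryOf_arc _ he]
          exact congr_bd' _ _ (congrArg (·, false) hm.symm)
        · rw [if_neg hfx] at hm
          rw [← s1', G.boundaryOf_arc _ he]
          exact congr_bd' _ _ (congrArg (·, false) hm.symm)
      · refine (G.boundaryOf_arc h hhm).trans (congr_bd' _ _ ?_)
        exact congrArg (·, false) (mergeNext_of_ne hhe hn).symm
    · exact G.boundaryOf_untwisted (hmem.1 hf).2 false i htf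
    · exact G.boundaryOf_twisted (hmem.1 hf).2 false i htf
    · obtain ⟨⟨⟨f, i⟩, j⟩, hc⟩ := c
      by_cases hfe : f = e
      · subst hfe
        cases j
        · exact ⟨⟨(r i, true), hre i⟩, s3 i⟩
        · exact ⟨⟨(r (!i), true), hre _⟩, (s3 (!i)).trans (s1 i).symm⟩
      · exact ⟨⟨((f, i), j), hmem.2 ⟨hfe, hc⟩⟩, rfl⟩

end Merge

end RibbonGraph

namespace RibbonGraph

variable {V E : Type*}

/-! ### Euler genus of a bouquet, and two facts about edges of connected ribbon graphs -/

theorem IsBouquet.eulerGenus_eq {B : RibbonGraph V E} (hB : B.IsBouquet) (hc : B.Connected) :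
    B.eulerGenus = (B.signedIntersectionGraph.adj.rank : ℤ) := by
  have h := hB.card_face
  have h1 : B.verts.card = 1 := hB
  rw [eulerGenus, eulerChar, hc.numComponents, h1]
  omega

/-- If both ends of an edge of a connected ribbon graph have degree one, there is nothing else. -/
theorem Connected.eq_of_next_eq [DecidableEq V] {G : RibbonGraph V E} {e : E}
    (hG : G.Connected) (he : e ∈ G.edges)
    (hfix : ∀ i, G.next (e, i) = (e, i)) :
    G.edges = {e} ∧ G.verts = {G.inc (e, false), G.inc (e, true)} := by
  have hend : ∀ (k : E × Bool) (i : Bool), k.1 ∈ G.edges → G.inc k = G.inc (e, i) → k = (e, i) := by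
    intro k i hk hki
    exact ((Equiv.Perm.SameCycle.symm (G.sameCycle_of_inc_eq k (e, i) hk he hki)).eq_of_left
      (hfix i)).symm
  have hmem : ∀ u ∈ G.verts, u = G.inc (e, false) ∨ u = G.inc (e, true) := by
    refine ((connected_simpleGraph_iff subset_rfl).1 hG).2 _ (fun f hf => ?_)
      ⟨_, G.inc_mem (e, false) he, Or.inl rfl⟩
    have : ∀ i, (G.inc (f, i) = G.inc (e, false) ∨ G.inc (f, i) = G.inc (e, true)) → f = e := by
      rintro i (h | h)
      · exact congrArg Prod.fst (hend _ _ hf h)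
      · exact congrArg Prod.fst (hend _ _ hf h)
    constructor <;> intro h <;> obtain rfl := this _ h <;> simp
  constructor
  · ext f
    rw [Finset.mem_singleton]
    refine ⟨fun hf => ?_, fun h => h ▸ he⟩
    rcases hmem _ (G.inc_mem (f, false) hf) with h | h
    · exact congrArg Prod.fst (hend _ _ hf h)
    · exact congrArg Prod.fst (hend _ _ hf h)
  · ext u
    rw [Finset.mem_insert, Finset.mem_singleton]
    refine ⟨hmem u, ?_⟩
    rintro (rfl | rfl)
    · exact G.inc_mem (e, false) he
    · exact G.inc_mem (e, true) he

/-- An edge of a connecting set of edges of minimal size is not a loop. -/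
theorem inc_ne_of_card_eq [DecidableEq E] {G : RibbonGraph V E} {e : E} {S : Finset E}
    (hS : S ⊆ G.edges) (hc : (G.simpleGraph S).Connected)
    (hcard : G.verts.card = S.card + 1) (he : e ∈ S) : G.inc (e, false) ≠ G.inc (e, true) := by
  -- A loop could be dropped without disconnecting, leaving fewer edges than `card_verts_le` allows.
  intro heq
  have hS' : S.erase e ⊆ G.edges := (Finset.erase_subset e S).trans hS
  have h1 : (G.simpleGraph (S.erase e)).Connected := by
    rw [connected_simpleGraph_iff hS] at hc
    rw [connected_simpleGraph_iff hS']
    refine ⟨hc.1, fun P hP => hc.2 P fun f hf => ?_⟩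
    by_cases hfe : f = e
    · rw [hfe, heq]
    · exact hP f (Finset.mem_erase.2 ⟨hfe, hf⟩)
  have h2 := card_verts_le hS' h1
  have h3 := Finset.card_erase_add_one he
  omega

variable [DecidableEq V] [DecidableEq E]

/-! ### Contraction preserves the Euler genus -/

section Merge

variable {G : RibbonGraph V E} {e : E} (he : e ∈ G.edges)
  (hne : G.inc (e, false) ≠ G.inc (e, true))

theorem connected_merge {S : Finset E} (hS : S ⊆ G.edges) (h : (G.simpleGraph S).Connected) :
    ((G.merge e he hne).simpleGraph (S.erase e)).Connected := by
  rw [connected_simpleGraph_iff hS] at h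
  rw [connected_simpleGraph_iff (Finset.erase_subset_erase e hS)]
  refine ⟨⟨_, Finset.mem_erase.2 ⟨hne, G.inc_mem (e, false) he⟩⟩, fun P hP ⟨v, hv, hPv⟩ u hu => ?_⟩
  obtain ⟨hv1, hv2⟩ := Finset.mem_erase.1 hv
  obtain ⟨hu1, hu2⟩ := Finset.mem_erase.1 hu
  -- The predicate is pulled back along the map that identifies the two ends of `e`.
  have key := h.2 (fun v => P (if v = G.inc (e, true) then G.inc (e, false) else v))
    (fun f hf => ?_) ⟨v, hv2, by rwa [if_neg hv1]⟩ u hu2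
  · rwa [if_neg hu1] at key
  · by_cases hfe : f = e
    · subst hfe
      rw [if_neg hne, if_pos rfl]
    · exact hP f (Finset.mem_erase.2 ⟨hfe, hf⟩)

/-- If `e` is alone at both ends, connectedness makes `G` two discs joined by one ribbon, with a
single face, and the result is an isolated disc. Otherwise `card_quot_merge` applies. -/
theorem Connected.card_face_merge (hG : G.Connected) (ht : ¬ G.Twisted e) :
    Nat.card (G.merge e he hne).Face = Nat.card G.Face := by
  rw [hG.card_face ⟨e, he⟩]
  by_cases hfix : ∃ i, G.next (e, i) ≠ (e, i)
  · have hE : (G.merge e he hne).edges.Nonempty := by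
      obtain ⟨i, hi⟩ := hfix
      exact ⟨(G.next (e, i)).1, Finset.mem_erase.2
        ⟨fun h => next_ne_other hne i (eq_other_of_ne h hi), G.next_mem he⟩⟩
    have hc : (G.merge e he hne).Connected := connected_merge he hne subset_rfl hG
    rw [hc.card_face hE, card_quot_merge he hne ht hfix]
  · push Not at hfix
    obtain ⟨hE, hV⟩ := hG.eq_of_next_eq he hfix
    have hE' : (G.merge e he hne).edges = ∅ := by simp [merge, hE]
    have hV' : (G.merge e he hne).verts.card = 1 := by
      change (G.verts.erase _).card = 1
      rw [Finset.card_erase_of_mem (G.inc_mem (e, true) he), hV, Finset.card_pair hne]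
    rw [card_face_of_edges_eq_empty hE', hV', eq_comm, Nat.card_eq_one_iff_unique]
    refine ⟨⟨fun a b => ?_⟩, ⟨G.boundaryOf ((e, false), false) he⟩⟩
    have arc : ∀ i, G.boundaryOf ((e, i), true) he = G.boundaryOf ((e, i), false) he := by
      intro i
      rw [G.boundaryOf_arc _ he]
      congr 2
      exact hfix i
    have h1 := G.boundaryOf_untwisted he false true ht
    have key : ∀ q : Quot G.BoundaryStep, q = G.boundaryOf ((e, false), false) he := by
      intro q
      induction q using Quot.ind with
      | mk c =>
        obtain ⟨⟨⟨f, i⟩, j⟩, hc⟩ := c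
        obtain rfl : f = e := by
          have : f ∈ G.edges := hc
          simpa [hE] using this
        change G.boundaryOf ((f, i), j) hc = _
        cases i <;> cases j
        · rfl
        · exact arc false
        · exact h1.symm.trans (arc false)
        · exact (arc true).trans (h1.symm.trans (arc false))
    rw [key a, key b]

theorem Connected.eulerGenus_merge (hG : G.Connected) (ht : ¬ G.Twisted e) :
    (G.merge e he hne).eulerGenus = G.eulerGenus := by
  have hc : (G.merge e he hne).Connected := connected_merge he hne subset_rfl hG
  rw [eulerGenus, eulerGenus, eulerChar, eulerChar, hG.card_face_merge he hne ht, hG.numComponents,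
    hc.numComponents]
  have h1 : (G.merge e he hne).verts.card + 1 = G.verts.card :=
    Finset.card_erase_add_one (G.inc_mem (e, true) he)
  have h2 : (G.merge e he hne).edges.card + 1 = G.edges.card := Finset.card_erase_add_one he
  omega

end Merge

/-- The effect of contracting an edge that is not a loop. -/
theorem contract_spec {G : RibbonGraph V E} {e : E} (he : e ∈ G.edges)
    (hne : G.inc (e, false) ≠ G.inc (e, true)) :
    (G.contract e).edges = G.edges.erase e ∧ (G.contract e).verts.card + 1 = G.verts.card ∧
      (∀ S ⊆ G.edges, (G.simpleGraph S).Connected →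
        ((G.contract e).simpleGraph (S.erase e)).Connected) ∧
      (G.Connected → (G.contract e).eulerGenus = G.eulerGenus) := by
  by_cases ht : G.Twisted e
  · have hcon : G.contract e = (G.flip (G.inc (e, true))).merge e he hne := by
      rw [contract, dif_pos ⟨he, hne⟩, if_pos ht]
    rw [hcon]
    refine ⟨rfl, Finset.card_erase_add_one (G.inc_mem (e, true) he), fun S hS h => ?_, fun h => ?_⟩
    · exact connected_merge (G := G.flip (G.inc (e, true))) he hne hS h
    · rw [← G.eulerGenus_flip (G.inc (e, true))]
      -- Exactly one end of `e` lies at the reversed disc, so `e` has become untwisted.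
      refine Connected.eulerGenus_merge (G := G.flip (G.inc (e, true))) he hne h ?_
      rw [flip_twisted_iff]
      simp [ht, hne]
  · have hcon : G.contract e = G.merge e he hne := by
      rw [contract, dif_pos ⟨he, hne⟩, if_neg ht]
    rw [hcon]
    exact ⟨rfl, Finset.card_erase_add_one (G.inc_mem (e, true) he),
      fun S hS h => connected_merge he hne hS h, fun h => h.eulerGenus_merge he hne ht⟩

/-- Instead of a tree, the induction carries a connecting set with one edge fewer than there are
vertices. This passes to the contraction at once and, by `inc_ne_of_card_eq`, forces the next edge
to join distinct discs, whatever the order. -/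
theorem aux_spec (l : List E) : ∀ G : RibbonGraph V E, l.Nodup → l.toFinset ⊆ G.edges →
    (G.simpleGraph l.toFinset).Connected → G.verts.card = l.length + 1 →
      (G.aux l).IsBouquet ∧ (G.aux l).edges = G.edges \ l.toFinset ∧ (G.aux l).Connected ∧
        (G.aux l).eulerGenus = G.eulerGenus := by
  induction l with
  | nil =>
    intro G _ hs hc hcard
    exact ⟨hcard, by simp [aux], connected_simpleGraph_mono hs hc, rfl⟩
  | cons e l ih =>
    intro G hl hs hc hcard
    obtain ⟨hel, hl'⟩ := List.nodup_cons.1 hl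
    have heS : e ∈ (e :: l).toFinset := by simp
    have he : e ∈ G.edges := hs heS
    have hne : G.inc (e, false) ≠ G.inc (e, true) :=
      inc_ne_of_card_eq hs hc (by rw [List.toFinset_card_of_nodup hl, hcard]) heS
    obtain ⟨h1, h2, h3, h4⟩ := contract_spec he hne
    have herase : (e :: l).toFinset.erase e = l.toFinset := by
      rw [List.toFinset_cons, Finset.erase_insert (by simpa using hel)]
    have hs' : l.toFinset ⊆ (G.contract e).edges := by
      rw [h1, ← herase]
      exact Finset.erase_subset_erase e hs
    obtain ⟨i1, i2, i3, i4⟩ := ih (G.contract e) hl' hs' (herase ▸ h3 _ hs hc)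
      (by rw [List.length_cons] at hcard; omega)
    refine ⟨i1, i2.trans ?_, i3, i4.trans (h4 (connected_simpleGraph_mono hs hc))⟩
    rw [h1, List.toFinset_cons]
    ext f
    simp only [Finset.mem_sdiff, Finset.mem_erase, Finset.mem_insert]
    tauto

end RibbonGraph

/-! ### The theorem, for an arbitrary ordering of the tree edges -/

theorem theorem1 {V E : Type*} [DecidableEq V] [DecidableEq E] (G : RibbonGraph V E)
    (hG : G.Connected) (T : Finset E) (hT : G.IsSpanningTree T)
    (l : List E) (hl : l.Nodup) (hlT : l.toFinset = T) :
    (G.aux l).IsBouquet ∧ (G.aux l).edges = G.edges \ T ∧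
      G.eulerGenus = ((G.aux l).signedIntersectionGraph.adj.rank : ℤ) := by
  subst hlT
  obtain ⟨h1, h2, h3, h4⟩ := RibbonGraph.aux_spec l G hl hT.subset hT.isTree.connected
    (by rw [hT.card_verts, List.toFinset_card_of_nodup hl])
  exact ⟨h1, h2, h4.symm.trans (h1.eulerGenus_eq h3)⟩
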